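/- A **tract** $F=(G,N_G)$ is an abelian group $G$ (written multiplicatively) together with a subset $N_G$ of the group semiring $\mathbb N[G]$ such that $0\in N_G$; $1\notin N_G$; there is a unique $\epsilon\in G$ with $1+\epsilon\in N_G$; and $N_G$ is closed under multiplication by elements of $G$. We identify $F$ with $G\cup\{0\}\subset\mathbb N[G]$ and write $-x=\epsilon x$. An **involution** of $F$ is a group homomorphism $x\mapsto\overline x$ of $G$ that squares to the identity and whose linear extension to $\mathbb N[G]$ maps $N_G$ into itself; put $\overline 0=0$. Fix such an involution (the identity unless otherwise specified). Let $E$ be a finite set. For $X\in F^E$ let $\underline X=\{e: X(e)\ne0\}$. Write $X\perp Y$ if $\sum_{e\in E}X(e)\overline{Y(e)}\in N_G$. For $\mathcal C\subseteq F^E$ put $\mathcal S=\{\underline X: X\in\mathcal C\}$. Two distinct members $A,B$ of $\mathcal S$ form a *modular pair* if $A\cup B$ does not properly contain the union of two distinct members of $\mathcal S$. A family of $n$ elements of $\mathcal C$ is *modular* if the union of their supports has height $n$ (the largest length of a chain ending at it) in the lattice of all unions of members of $\mathcal S$, including $\emptyset$, ordered by inclusion. A set $\mathcal C\subseteq F^E$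 is the circuit set of a **weak $F$-matroid** on $E$ if * (C0) $0\notin\mathcal C$; * (C1) $\alpha X\in\mathcal C$ for all $X\in\mathcal C$, $\alpha\in G$; * (C2) if $X,Y\in\mathcal C$ and $\underline X\subseteq\underline Y$, then $X=\alpha Y$ for some $\alpha\in G$; * (C3)$'$ if $X,Y\in\mathcal C$, $\underline X,\underline Y$ form a modular pair and $X(e)=-Y(e)\neq0$, then there is $Z\in\mathcal C$ with $Z(e)=0$ and $X(f)+Y(f)-Z(f)\in N_G$ for all $f\in E$. It is the circuit set of a **strong $F$-matroid** on $E$ if it satisfies (C0), (C1), (C2) and * (C3) if $X_1,\dots,X_k,X\in\mathcal C$ form a modular family of size $k+1$ with $\underline X\not\subseteq\bigcup_i\underline X_i$, and $e_i\in(\underline X\cap\underline X_i)\setminus\bigcup_{j\ne i}\underline X_j$ satisfies $X(e_i)=-X_i(e_i)$ for $1\le i\le k$, then there is $Z\in\mathcal C$ with $Z(e_i)=0$ for all $i$ and $X_1(f)+\cdots+X_k(f)+X(f)-Z(f)\in N_G$ for all $f\in E$. The **cocircuits** of such a matroid are the elements of minimal support of $\{Y\in F^E\setminus\{0\}: Y\perp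 X\text{ for all }X\in\mathcal C\}$. A **vector** is an element of $F^E$ orthogonal to all cocircuits, and a **covector** is an element of $F^E$ orthogonal to all elements of $\mathcal C$. The tract $F$ is **perfect** if, for every strong $F$-matroid on any finite set, every vector is orthogonal to every covector. **Theorem.** If $F$ is a perfect tract, then every weak $F$-matroid $M$ on a finite set $E$ is strong; that is, every $\mathcal C\subseteq F^E$ satisfying (C0), (C1), (C2) and (C3)$'$ also satisfies (C3). -/

import Mathlib

universe u v

/-- A tract with multiplicative group `G`: an additive relation structure on the abelian group `G`,
that is, a set `null` of formal sums in the group semiring `ℕ[G]`. The underlying set of the tract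
is `G ∪ {0}`, written `WithZero G`. -/
structure Tract (G : Type*) [CommGroup G] where
  /-- the formal sums that are declared to sum to zero -/
  null : Set (MonoidAlgebra ℕ G)
  zero_mem : (0 : MonoidAlgebra ℕ G) ∈ null
  one_notMem : (1 : MonoidAlgebra ℕ G) ∉ null
  existsUnique_eps : ∃! ε : G, 1 + MonoidAlgebra.single ε 1 ∈ null
  single_mul_mem : ∀ (g : G) (a : MonoidAlgebra ℕ G), a ∈ null →
    MonoidAlgebra.single g 1 * a ∈ null

namespace Tract

/-- The inclusion of `G ∪ {0}` in the group semiring `ℕ[G]`. -/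
noncomputable def incl {G : Type*} [CommGroup G] : WithZero G → MonoidAlgebra ℕ G
  | 0 => 0
  | (g : G) => MonoidAlgebra.single g 1

/-- The unique `ε` in `G` with `1 + ε` in the null set; it plays the role of `-1`. -/
noncomputable def eps {G : Type*} [CommGroup G] (F : Tract G) : G :=
  F.existsUnique_eps.choose

/-- The negative `-x = ε x` of an element of the tract. -/
noncomputable def neg {G : Type*} [CommGroup G] (F : Tract G) (x : WithZero G) : WithZero G :=
  (F.eps : WithZero G) * x

/-- An involution of a tract: a tract homomorphism from `F` to `F` whose square is the identity. -/
structure Involution {G : Type*} [CommGroup G] (F : Tract G) where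
  toHom : G →* G
  map_null : ∀ a ∈ F.null, MonoidAlgebra.mapDomain toHom a ∈ F.null
  involutive : ∀ g : G, toHom (toHom g) = g

/-- The action of an involution on `G ∪ {0}`. -/
noncomputable def Involution.conj {G : Type*} [CommGroup G] {F : Tract G} (τ : F.Involution) :
    WithZero G → WithZero G :=
  WithZero.map' τ.toHom

/-- The identity involution. -/
noncomputable def Involution.id {G : Type*} [CommGroup G] (F : Tract G) : F.Involution where
  toHom := MonoidHom.id G
  map_null := fun a ha => by
    have h : MonoidAlgebra.mapDomain (MonoidHom.id G) a = a := by
      simp only [MonoidAlgebra.mapDomain, MonoidHom.coe_id, Finsupp.mapDomain_id]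
    rwa [h]
  involutive := fun _ => rfl

/-- The support of a vector with entries in `G ∪ {0}`. -/
def supp {G E : Type*} (X : E → WithZero G) : Set E := {e | X e ≠ 0}

/-- `{supp X | X ∈ C}`. -/
def supports {G E : Type*} (C : Set (E → WithZero G)) : Set (Set E) := supp '' C

/-- Orthogonality `X ⊥ Y`: the formal sum of the products `X(e) * conj Y(e)` is null. -/
def Orthogonal {G : Type*} [CommGroup G] (F : Tract G) (τ : F.Involution) {E : Type*} [Fintype E]
    (X Y : E → WithZero G) : Prop :=
  ∑ e, incl (X e * τ.conj (Y e)) ∈ F.null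

/-- Two members of a collection `S` of sets form a modular pair: they are distinct and their union
does not properly contain a union of two distinct members of `S`. -/
def IsModularPair {E : Type*} (S : Set (Set E)) (A B : Set E) : Prop :=
  A ∈ S ∧ B ∈ S ∧ A ≠ B ∧
    ∀ A' ∈ S, ∀ B' ∈ S, A' ≠ B' → ¬ (A' ∪ B' ⊂ A ∪ B)

/-- The lattice of all unions of members of `S` (including the empty union), ordered by
inclusion. -/
def unions {E : Type*} (S : Set (Set E)) : Set (Set E) := {U | ∃ T ⊆ S, U = ⋃₀ T}

/-- A family of `n` members of `S` is modular if its union has height `n` in the lattice of unions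
of members of `S`. -/
def IsModularFamily {E : Type*} (S : Set (Set E)) {n : ℕ} (A : Fin n → Set E) : Prop :=
  (∀ i, A i ∈ S) ∧
    ∃ h : (⋃ i, A i) ∈ unions S, Order.height (⟨⋃ i, A i, h⟩ : unions S) = n

/-- `C` is the set of `F`-circuits of a weak `F`-matroid on `E`. -/
structure IsWeakCircuitSet {G : Type*} [CommGroup G] (F : Tract G) {E : Type*}
    (C : Set (E → WithZero G)) : Prop where
  zero_notMem : (0 : E → WithZero G) ∉ C
  smul_mem : ∀ X ∈ C, ∀ α : G, (fun e => (α : WithZero G) * X e) ∈ C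
  incomparable : ∀ X ∈ C, ∀ Y ∈ C, supp X ⊆ supp Y →
    ∃ α : G, X = fun e => (α : WithZero G) * Y e
  modular_elimination : ∀ X ∈ C, ∀ Y ∈ C, IsModularPair (supports C) (supp X) (supp Y) →
    ∀ e : E, X e = F.neg (Y e) → X e ≠ 0 →
      ∃ Z ∈ C, Z e = 0 ∧ ∀ f, incl (X f) + incl (Y f) + incl (F.neg (Z f)) ∈ F.null

/-- `C` is the set of `F`-circuits of a strong `F`-matroid on `E`. -/
structure IsStrongCircuitSet {G : Type*} [CommGroup G] (F : Tract G) {E : Type*}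
    (C : Set (E → WithZero G)) : Prop where
  zero_notMem : (0 : E → WithZero G) ∉ C
  smul_mem : ∀ X ∈ C, ∀ α : G, (fun e => (α : WithZero G) * X e) ∈ C
  incomparable : ∀ X ∈ C, ∀ Y ∈ C, supp X ⊆ supp Y →
    ∃ α : G, X = fun e => (α : WithZero G) * Y e
  strong_modular_elimination : ∀ (k : ℕ) (Xs : Fin k → E → WithZero G) (X : E → WithZero G)
      (e : Fin k → E), (∀ i, Xs i ∈ C) → X ∈ C →
    IsModularFamily (supports C) (Fin.cons (supp X) (fun i => supp (Xs i)) : Fin (k + 1) → Set E) →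
    ¬ supp X ⊆ ⋃ i, supp (Xs i) →
    (∀ i, e i ∈ supp X ∩ supp (Xs i) ∧ ∀ j, j ≠ i → e i ∉ supp (Xs j)) →
    (∀ i, X (e i) = F.neg (Xs i (e i))) →
      ∃ Z ∈ C, (∀ i, Z (e i) = 0) ∧
        ∀ f, ∑ i, incl (Xs i f) + incl (X f) + incl (F.neg (Z f)) ∈ F.null

/-- The `F`-cocircuits: the elements of minimal support among the non-zero vectors that are
orthogonal to every element of `C`. -/
def cocircuits {G : Type*} [CommGroup G] (F : Tract G) (τ : F.Involution) {E : Type*} [Fintype E]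
    (C : Set (E → WithZero G)) : Set (E → WithZero G) :=
  let S : Set (E → WithZero G) := {Y | (∀ X ∈ C, F.Orthogonal τ Y X) ∧ Y ≠ 0}
  {Y | Y ∈ S ∧ ∀ Y' ∈ S, supp Y' ⊆ supp Y → supp Y' = supp Y}

/-- `X` is a vector of the matroid with circuit set `C`: it is orthogonal to all cocircuits. -/
def IsVector {G : Type*} [CommGroup G] (F : Tract G) (τ : F.Involution) {E : Type*} [Fintype E]
    (C : Set (E → WithZero G)) (X : E → WithZero G) : Prop :=
  ∀ Y ∈ F.cocircuits τ C, F.Orthogonal τ X Y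

/-- `Y` is a covector of the matroid with circuit set `C`: it is orthogonal to all circuits. -/
def IsCovector {G : Type*} [CommGroup G] (F : Tract G) (τ : F.Involution) {E : Type*} [Fintype E]
    (C : Set (E → WithZero G)) (Y : E → WithZero G) : Prop :=
  ∀ X ∈ C, F.Orthogonal τ Y X

/-- `F` is perfect: for every strong `F`-matroid, on any finite set `E`, all vectors are orthogonal
to all covectors. (As `E` is finite, the choice of the universe `v` is immaterial.) -/
def IsPerfect {G : Type u} [CommGroup G] (F : Tract G) (τ : F.Involution) : Prop :=
  ∀ (E : Type v) [Fintype E] (C : Set (E → WithZero G)), F.IsStrongCircuitSet C →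
    ∀ X Y : E → WithZero G, F.IsVector τ C X → F.IsCovector τ C Y → F.Orthogonal τ X Y

end Tract

/-! Over a perfect tract the circuits of a weak matroid are orthogonal to suitable vectors on its
cocircuits, and this orthogonality implies (C3).

Modular elimination makes the supports the circuits of a matroid (`exists_isSignature`). Circuits
with the same two-element trace on a cocircuit are proportional there, so every cocircuit carries a
vector, unique up to scaling, that is orthogonal to the circuits meeting it in two elements
(`exists_isCocircuitVector`). Three common elements need one more elimination
(`pairing_mem_of_inter_eq_triple`). If the common support T has at least four elements, pass to a
minor on T of nullity two. A signature of nullity at most two is automatically strong, so perfection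
applies to it. Circuits and cocircuits of the minor are proper subsets of T, so by induction on |T|
the given circuit becomes a vector and the given cocircuit a covector, and these are orthogonal
(`pairing_mem_of_forall_lt`).

For (C3), modularity leaves a single circuit Z in the union of the supports minus the e_i
(`eq_of_height_le`). Scale Z to agree with X at a point outside all X_i. The relation at f,
multiplied by Y(f) for a suitable cocircuit vector Y, is the pairing of X with Y
(`exists_strong_elimination`). Pairings are taken without the involution, which enters only where
perfection is invoked. -/

namespace Matroid

open Set

/-! ### Circuit axioms and sets of small nullity -/

/-- A family of sets on a finite type which satisfies the circuit axioms is the family of circuits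
of a matroid. -/
theorem exists_isCircuit_iff_of_elimination {E : Type*} [Finite E] (S : Set (Set E))
    (hempty : ∅ ∉ S) (hanti : ∀ A ∈ S, ∀ B ∈ S, A ⊆ B → A = B)
    (helim : ∀ A ∈ S, ∀ B ∈ S, A ≠ B → ∀ e ∈ A ∩ B, ∃ Z ∈ S, Z ⊆ (A ∪ B) \ {e}) :
    ∃ M : Matroid E, M.E = univ ∧ ∀ A, M.IsCircuit A ↔ A ∈ S := by
  classical
  let Ind : Set E → Prop := fun I => ∀ A ∈ S, ¬ A ⊆ I
  have haug : ∀ ⦃I J⦄, Ind I → Ind J → I.ncard < J.ncard → ∃ e ∈ J, e ∉ I ∧ Ind (insert e I) := by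
    intro I J hI hJ hlt
    -- Among the independent subsets of I ∪ J larger than I, take one that misses as little of I as
    -- possible; it has to contain I.
    let P : Set (Set E) := {K | Ind K ∧ K ⊆ I ∪ J ∧ I.ncard < K.ncard}
    obtain ⟨K, ⟨hK, hKIJ, hIK⟩, hKmin⟩ := exists_min_image P (fun K => (I \ K).ncard) (toFinite P)
      ⟨J, hJ, subset_union_right, hlt⟩
    by_cases hsub : I ⊆ K
    · obtain ⟨e, heK, heI⟩ := exists_mem_notMem_of_ncard_lt_ncard hIK
      refine ⟨e, (hKIJ heK).resolve_left heI, heI, fun A hA hAe => hK A hA (hAe.trans ?_)⟩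
      exact insert_subset heK hsub
    · exfalso
      obtain ⟨e, heI, heK⟩ := not_subset.1 hsub
      -- Exchanging f for e would miss less of I, so K + e - f is dependent, and a circuit in it
      -- must use e.
      have key : ∀ f ∈ K, f ∉ I → ∃ A ∈ S, A ⊆ insert e K \ {f} ∧ e ∈ A := by
        intro f hfK hfI
        have hnot : insert e K \ {f} ∉ P := by
          intro hP
          have hle := hKmin _ hP
          refine absurd hle (not_le.2 (ncard_lt_ncard ⟨?_, fun h => ?_⟩))
          · rintro z ⟨hzI, hz⟩
            refine ⟨hzI, fun hzK => hz ⟨Or.inr hzK, ?_⟩⟩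
            rintro rfl
            exact hfI hzI
          · refine (h ⟨heI, heK⟩).2 ⟨mem_insert _ _, ?_⟩
            rintro rfl
            exact heK hfK
        have hcard : (insert e K \ {f}).ncard = K.ncard := by
          rw [ncard_sdiff_singleton_of_mem (mem_insert_of_mem e hfK), ncard_insert_of_notMem heK]
          simp
        have hsubIJ : insert e K \ {f} ⊆ I ∪ J :=
          sdiff_subset.trans (insert_subset (Or.inl heI) hKIJ)
        have : ¬ Ind (insert e K \ {f}) := fun h => hnot ⟨h, hsubIJ, by rw [hcard]; exact hIK⟩
        obtain ⟨A, hA, hAsub⟩ : ∃ A ∈ S, A ⊆ insert e K \ {f} := by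
          by_contra h
          exact this fun A hA hAs => h ⟨A, hA, hAs⟩
        refine ⟨A, hA, hAsub, by_contra fun heA => hK A hA fun z hz => ?_⟩
        rcases (hAsub hz).1 with rfl | h
        exacts [(heA hz).elim, h]
      obtain ⟨g, hgK, hgI⟩ := exists_mem_notMem_of_ncard_lt_ncard hIK
      obtain ⟨A, hA, hAs, heA⟩ := key g hgK hgI
      obtain ⟨h, hhA, hhI⟩ := not_subset.1 (hI A hA)
      have hhK : h ∈ K := by
        rcases (hAs hhA).1 with rfl | h'
        exacts [(hhI heI).elim, h']
      obtain ⟨B, hB, hBs, heB⟩ := key h hhK hhI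
      have hAB : A ≠ B := by
        rintro rfl
        exact (hBs hhA).2 rfl
      -- A and B are distinct circuits in K + e; eliminating e leaves a circuit inside the
      -- independent set K.
      obtain ⟨Z, hZ, hZs⟩ := helim A hA B hB hAB e ⟨heA, heB⟩
      refine hK Z hZ fun z hz => ?_
      have hze : z ≠ e := (hZs hz).2
      rcases (hZs hz).1 with h | h
      · exact (hAs h).1.resolve_left hze
      · exact (hBs h).1.resolve_left hze
  let N := IndepMatroid.ofFinite (E := (univ : Set E)) finite_univ Ind
    (fun A hA h => hempty (subset_empty_iff.1 h ▸ hA))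
    (fun I J hJ hIJ A hA h => hJ A hA (h.trans hIJ)) haug (fun _ _ => subset_univ _)
  refine ⟨N.matroid, rfl, fun A => ?_⟩
  have hN : ∀ I, N.matroid.Indep I ↔ Ind I := fun I => Iff.rfl
  rw [isCircuit_iff_minimal_not_indep (subset_univ _)]
  simp only [hN]
  have hnot : ∀ {I}, ¬ Ind I → ∃ B ∈ S, B ⊆ I := by
    intro I h
    by_contra h'
    exact h fun B hB hBI => h' ⟨B, hB, hBI⟩
  constructor
  · intro h
    obtain ⟨B, hB, hBA⟩ := hnot h.prop
    have : A ⊆ B := h.le_of_le (y := B) (fun hind => hind B hB Subset.rfl) hBA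
    rwa [this.antisymm hBA]
  · intro hA
    refine ⟨fun hind => hind A hA Subset.rfl, fun I hI hIA => ?_⟩
    obtain ⟨B, hB, hBI⟩ := hnot hI
    rw [← hanti B hB A hA (hBI.trans hIA)]
    exact hBI

variable {E : Type*} {M : Matroid E}

theorem IsCircuit.eq_of_subset_of_indep_sdiff_singleton {A B W : Set E} {w : E}
    (hA : M.IsCircuit A) (hB : M.IsCircuit B) (hAW : A ⊆ W) (hBW : B ⊆ W)
    (hW : M.Indep (W \ {w})) : A = B := by
  have h : W ⊆ insert w (W \ {w}) := by
    rw [insert_sdiff_singleton]; exact subset_insert _ _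
  rw [hA.eq_fundCircuit_of_subset hW (hAW.trans h), hB.eq_fundCircuit_of_subset hW (hBW.trans h)]

/-- Deleting a point of a circuit preserves the rank, so a basis of W \ {e} is a basis of W; its
complement in W has at most two elements, one of them e. -/
theorem IsCircuit.exists_indep_sdiff_pair [Finite E] {X W : Set E} {x y e : E}
    (hX : M.IsCircuit X) (hXW : X ⊆ W) (hWE : W ⊆ M.E) (heX : e ∈ X)
    (hW : M.Indep (W \ {x, y})) : ∃ w, M.Indep (W \ {e, w}) := by
  obtain ⟨J, hJ, hWJ⟩ := hW.subset_isBasis_of_subset sdiff_subset hWE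
  obtain ⟨I, hI⟩ := M.exists_isBasis (W \ {e}) (sdiff_subset.trans hWE)
  have hIW : M.IsBasis I W := by
    rw [isBasis_iff_indep_subset_closure]
    refine ⟨hI.indep, hI.subset.trans sdiff_subset, fun z hz => ?_⟩
    rw [hI.closure_eq_closure]
    by_cases hze : z = e
    · subst hze
      exact M.closure_subset_closure (sdiff_subset_sdiff_left hXW)
        (hX.mem_closure_sdiff_singleton_of_mem heX)
    · exact M.mem_closure_of_mem ⟨hz, hze⟩ (sdiff_subset.trans hWE)
  have hcard : I.ncard = J.ncard := by
    rw [ncard_def, ncard_def, hIW.encard_eq_encard hJ]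
  have h1 : (W \ I).ncard = (W \ J).ncard := by
    have a := ncard_sdiff_add_ncard_of_subset hIW.subset
    have b := ncard_sdiff_add_ncard_of_subset hJ.subset
    omega
  have h2 : (W \ J).ncard ≤ 2 := by
    refine (ncard_le_ncard (t := {x, y}) ?_).trans
      ((ncard_insert_le x {y}).trans (by simp))
    intro z hz
    by_contra hzxy
    exact hz.2 (hWJ ⟨hz.1, hzxy⟩)
  have heI : e ∉ I := fun h => (hI.subset h).2 rfl
  have heW : e ∈ W \ I := ⟨hXW heX, heI⟩
  have h3 : ((W \ I) \ {e}).ncard ≤ 1 := by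
    rw [ncard_sdiff_singleton_of_mem heW]; omega
  have : Nonempty E := ⟨e⟩
  rw [ncard_le_one_iff_subset_singleton] at h3
  obtain ⟨w, hw⟩ := h3
  refine ⟨w, hI.indep.subset fun z hz => ?_⟩
  by_contra hzI
  have : z ∈ ({w} : Set E) := hw ⟨⟨hz.1, hzI⟩, fun h => hz.2 (Or.inl h)⟩
  exact hz.2 (Or.inr this)

/-- If `W` has nullity at most two, then the circuits in `W` that avoid a given element of some
circuit in `W` are all equal. -/
theorem IsCircuit.eq_of_indep_sdiff_pair [Finite E] {X A B W : Set E} {x y e : E}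
    (hX : M.IsCircuit X) (hA : M.IsCircuit A) (hB : M.IsCircuit B) (hXW : X ⊆ W)
    (hW : M.Indep (W \ {x, y})) (heX : e ∈ X) (hAW : A ⊆ W \ {e}) (hBW : B ⊆ W \ {e}) :
    A = B := by
  obtain ⟨w, hw⟩ := hX.exists_indep_sdiff_pair (W := W ∩ M.E) (subset_inter hXW hX.subset_ground)
    inter_subset_right heX (hW.subset (sdiff_subset_sdiff_left inter_subset_left))
  refine hA.eq_of_subset_of_indep_sdiff_singleton hB (W := (W ∩ M.E) \ {e}) (w := w)
    (fun z hz => ⟨⟨(hAW hz).1, hA.subset_ground hz⟩, (hAW hz).2⟩)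
    (fun z hz => ⟨⟨(hBW hz).1, hB.subset_ground hz⟩, (hBW hz).2⟩) (hw.subset ?_)
  rintro z ⟨⟨hz, h1⟩, h2⟩
  exact ⟨hz, by rintro (h | h); exacts [h1 h, h2 h]⟩

/-! ### Cocircuits and hyperplanes -/

/-- The complement of a cocircuit is a maximal nonspanning set, and e makes S strictly larger. -/
theorem IsCocircuit.spanning_of_compl_ssubset {K S : Set E} {e : E} (hK : M.IsCocircuit K)
    (he : e ∈ K) (heS : e ∈ S) (hS : M.E \ K ⊆ S) (hSE : S ⊆ M.E) : M.Spanning S := by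
  rw [isCocircuit_iff_minimal_compl_nonspanning] at hK
  by_contra h
  have h1 : M.E \ (M.E \ S) = S := sdiff_sdiff_cancel_left hSE
  have h2 : M.E \ S ⊆ K := fun z hz => by_contra fun hzK => hz.2 (hS ⟨hz.1, hzK⟩)
  have := hK.le_of_le (y := M.E \ S) (by simpa only [h1] using h) h2
  exact (this he).2 heS

theorem IsCocircuit.insert_isBase {K I : Set E} {e : E} (hK : M.IsCocircuit K)
    (hI : M.IsBasis I (M.E \ K)) (he : e ∈ K) : M.IsBase (insert e I) := by
  have heE := hK.subset_ground he
  have hns : ¬ M.Spanning (M.E \ K) :=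
    (isCocircuit_iff_minimal_compl_nonspanning.1 hK).prop
  have hsp : M.Spanning (insert e (M.E \ K)) :=
    hK.spanning_of_compl_ssubset he (mem_insert _ _) (subset_insert _ _)
      (insert_subset heE sdiff_subset)
  have hcl : M.closure (insert e I) = M.E := by
    rw [← closure_insert_closure_eq_closure_insert, hI.closure_eq_closure,
      closure_insert_closure_eq_closure_insert, hsp.closure_eq]
  have heI : e ∉ I := fun h => (hI.subset h).2 he
  have hecl : e ∉ M.closure I := by
    intro h
    apply hns
    rw [spanning_iff_closure_eq, ← hI.closure_eq_closure, ← hcl]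
    exact (closure_insert_eq_of_mem_closure h).symm
  rw [isBase_iff_indep_closure_eq]
  exact ⟨(hI.indep.insert_indep_iff_of_notMem heI).2 ⟨heE, hecl⟩, hcl⟩

/-- For a basis `I` of the hyperplane complementary to the cocircuit `K`, there is a circuit in
`I ∪ {e, f}` through `e` and `f`. -/
theorem IsCocircuit.exists_isCircuit_of_isBasis {K I : Set E} {e f : E} (hK : M.IsCocircuit K)
    (hI : M.IsBasis I (M.E \ K)) (he : e ∈ K) (hf : f ∈ K) (hef : e ≠ f) :
    ∃ X, M.IsCircuit X ∧ X ⊆ I ∪ {e, f} ∧ X ∩ K = {e, f} := by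
  have heB := hK.insert_isBase hI he
  have hfB := hK.insert_isBase hI hf
  have hfI : f ∉ insert e I := by
    rintro (h | h)
    · exact hef h.symm
    · exact (hI.subset h).2 hf
  have hX := heB.fundCircuit_isCircuit (hK.subset_ground hf) hfI
  have hsub := M.fundCircuit_subset_insert f (insert e I)
  have hfX := M.mem_fundCircuit f (insert e I)
  have heX : e ∈ M.fundCircuit f (insert e I) := by
    by_contra h
    -- Without e the circuit would lie in the base I + f.
    refine hX.not_indep (hfB.indep.subset fun z hz => ?_)
    rcases hsub hz with rfl | rfl | hz'
    · exact mem_insert _ _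
    · exact (h hz).elim
    · exact Or.inr hz'
  refine ⟨_, hX, fun z hz => ?_, ?_⟩
  · rcases hsub hz with rfl | rfl | hz'
    · simp
    · simp
    · exact Or.inl hz'
  · ext z
    constructor
    · rintro ⟨hz, hzK⟩
      rcases hsub hz with rfl | rfl | hz'
      · simp
      · simp
      · exact ((hI.subset hz').2 hzK).elim
    · rintro (rfl | rfl)
      exacts [⟨heX, he⟩, ⟨hfX, hf⟩]

theorem IsCocircuit.exists_isCircuit_inter_eq_pair {K : Set E} {e f : E} (hK : M.IsCocircuit K)
    (he : e ∈ K) (hf : f ∈ K) (hef : e ≠ f) : ∃ X, M.IsCircuit X ∧ X ∩ K = {e, f} := by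
  obtain ⟨I, hI⟩ := M.exists_isBasis (M.E \ K) sdiff_subset
  obtain ⟨X, hX, -, h⟩ := hK.exists_isCircuit_of_isBasis hI he hf hef
  exact ⟨X, hX, h⟩

end Matroid

/-! ### Arithmetic of tracts, pairings and involutions -/

namespace Tract

variable {G : Type*} [CommGroup G]

@[simp] theorem incl_zero : incl (0 : WithZero G) = 0 := rfl

theorem incl_coe (g : G) : incl (g : WithZero G) = MonoidAlgebra.single g 1 := rfl

theorem incl_mul (a b : WithZero G) : incl (a * b) = incl a * incl b := by
  induction a with
  | zero => simp
  | coe a =>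
    induction b with
    | zero => simp
    | coe b => rw [← WithZero.coe_mul, incl_coe, incl_coe, incl_coe,
        MonoidAlgebra.single_mul_single, mul_one]

variable {F : Tract G}

theorem incl_mul_mem (a : WithZero G) {x : MonoidAlgebra ℕ G} (hx : x ∈ F.null) :
    incl a * x ∈ F.null := by
  induction a with
  | zero => simpa using F.zero_mem
  | coe g => exact F.single_mul_mem g x hx

theorem mem_null_of_incl_mul_mem {a : WithZero G} (ha : a ≠ 0) {x : MonoidAlgebra ℕ G}
    (hx : incl a * x ∈ F.null) : x ∈ F.null := by
  have h := incl_mul_mem a⁻¹ hx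
  rw [← mul_assoc, ← incl_mul, inv_mul_cancel₀ ha] at h
  have h1 : incl (1 : WithZero G) = 1 := rfl
  rwa [h1, one_mul] at h

theorem incl_mem_null_iff {a : WithZero G} : incl a ∈ F.null ↔ a = 0 := by
  refine ⟨fun h => by_contra fun ha => F.one_notMem ?_, fun h => by simpa [h] using F.zero_mem⟩
  exact mem_null_of_incl_mul_mem ha (by rwa [mul_one])

theorem one_add_eps_mem (F : Tract G) : 1 + MonoidAlgebra.single F.eps 1 ∈ F.null :=
  F.existsUnique_eps.choose_spec.1

theorem eq_eps_of_one_add_mem {g : G} (h : 1 + MonoidAlgebra.single g 1 ∈ F.null) : g = F.eps :=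
  F.existsUnique_eps.choose_spec.2 g h

theorem incl_add_incl_neg_mem (a : WithZero G) : incl a + incl (F.neg a) ∈ F.null := by
  have h := incl_mul_mem a F.one_add_eps_mem
  rwa [mul_add, mul_one, ← incl_coe, ← incl_mul, mul_comm a] at h

/-- Multiplication by a⁻¹ reduces uniqueness of additive inverses to uniqueness of ε. -/
theorem incl_add_incl_mem_iff {a b : WithZero G} : incl a + incl b ∈ F.null ↔ b = F.neg a := by
  refine ⟨fun h => ?_, fun h => h ▸ incl_add_incl_neg_mem a⟩
  by_cases ha : a = 0
  · subst ha
    rw [incl_zero, zero_add, incl_mem_null_iff] at h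
    simp [h, neg]
  · have h1 : a * (a⁻¹ * b) = b := by rw [← mul_assoc, mul_inv_cancel₀ ha, one_mul]
    have h2 : 1 + incl (a⁻¹ * b) ∈ F.null :=
      mem_null_of_incl_mul_mem ha (by rwa [mul_add, mul_one, ← incl_mul, h1])
    generalize a⁻¹ * b = c at h1 h2
    induction c with
    | zero => exact (F.one_notMem (by simpa using h2)).elim
    | coe c =>
      rw [← h1, eq_eps_of_one_add_mem h2, neg, mul_comm]

@[simp] theorem neg_zero : F.neg 0 = 0 := mul_zero _

@[simp] theorem neg_neg (a : WithZero G) : F.neg (F.neg a) = a := by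
  have h := incl_add_incl_neg_mem (F := F) a
  rw [add_comm] at h
  exact (incl_add_incl_mem_iff.1 h).symm

theorem neg_mul (a b : WithZero G) : F.neg a * b = F.neg (a * b) := mul_assoc _ _ _

theorem mul_neg (a b : WithZero G) : a * F.neg b = F.neg (a * b) := mul_left_comm _ _ _

theorem neg_eq_zero {a : WithZero G} : F.neg a = 0 ↔ a = 0 := by
  simp [neg]

theorem eq_neg_iff {a b : WithZero G} : a = F.neg b ↔ b = F.neg a :=
  ⟨fun h => by rw [h, neg_neg], fun h => by rw [h, neg_neg]⟩

@[simp] theorem neg_inj {a b : WithZero G} : F.neg a = F.neg b ↔ a = b :=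
  ⟨fun h => by rw [← neg_neg (F := F) a, h, neg_neg], fun h => h ▸ rfl⟩

/-- The rescaling of a vector by an element of `G`. -/
abbrev scale {E : Type*} (α : G) (X : E → WithZero G) : E → WithZero G :=
  fun e => (α : WithZero G) * X e

theorem mem_supp {G E : Type*} {X : E → WithZero G} {e : E} : e ∈ supp X ↔ X e ≠ 0 := Iff.rfl

theorem notMem_supp {G E : Type*} {X : E → WithZero G} {e : E} : e ∉ supp X ↔ X e = 0 := not_not

@[simp] theorem supp_scale {E : Type*} (α : G) (X : E → WithZero G) :
    supp (scale α X) = supp X := by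
  ext e; simp [supp]

theorem supp_indicator {G E : Type*} (A : Set E) (X : E → WithZero G) :
    supp (Aᶜ.indicator X) = supp X \ A := by
  ext e
  by_cases he : e ∈ A <;> simp [supp, he]

theorem exists_coe_eq {a b : WithZero G} (ha : a ≠ 0) (hb : b ≠ 0) :
    ∃ α : G, (α : WithZero G) * a = b := by
  obtain ⟨α, hα⟩ := WithZero.ne_zero_iff_exists.1 (mul_ne_zero hb (inv_ne_zero ha))
  exact ⟨α, by rw [hα, mul_assoc, inv_mul_cancel₀ ha, mul_one]⟩

variable {E : Type*} [Fintype E]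

/-- The formal sum `∑ X(e) Y(e)`. -/
noncomputable def pairing (X Y : E → WithZero G) : MonoidAlgebra ℕ G := ∑ e, incl (X e * Y e)

theorem pairing_comm (X Y : E → WithZero G) : pairing X Y = pairing Y X := by
  simp only [pairing, mul_comm]

theorem pairing_eq_sum {X Y : E → WithZero G} {s : Finset E} (h : supp X ∩ supp Y ⊆ s) :
    pairing X Y = ∑ e ∈ s, incl (X e * Y e) := by
  refine (Finset.sum_subset (Finset.subset_univ s) fun e _ he => ?_).symm
  have : ¬ (X e ≠ 0 ∧ Y e ≠ 0) := fun h' => he (h h')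
  have : X e * Y e = 0 := by
    by_contra h0
    exact this ⟨left_ne_zero_of_mul h0, right_ne_zero_of_mul h0⟩
  rw [this, incl_zero]

/-- With two common elements, orthogonality fixes one product in terms of the other; coordinates of
circuits and cocircuits are compared through this. -/
theorem pairing_pair {X Y : E → WithZero G} {a b : E} (hab : a ≠ b)
    (h : supp X ∩ supp Y ⊆ {a, b}) :
    pairing X Y ∈ F.null ↔ X b * Y b = F.neg (X a * Y a) := by
  classical
  rw [pairing_eq_sum (s := {a, b}) (by simpa using h), Finset.sum_pair hab, incl_add_incl_mem_iff]

theorem pairing_mem_of_disjoint {X Y : E → WithZero G} (h : supp X ∩ supp Y = ∅) :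
    pairing X Y ∈ F.null := by
  rw [pairing_eq_sum (s := ∅) (by simp [h]), Finset.sum_empty]
  exact F.zero_mem

theorem pairing_scale_mem_iff (α : G) (X Y : E → WithZero G) :
    pairing (scale α X) Y ∈ F.null ↔ pairing X Y ∈ F.null := by
  have : pairing (scale α X) Y = incl (α : WithZero G) * pairing X Y := by
    simp only [pairing, Finset.mul_sum, ← incl_mul, mul_assoc]
  rw [this]
  exact ⟨mem_null_of_incl_mul_mem WithZero.coe_ne_zero, incl_mul_mem _⟩

theorem pairing_congr_of_eqOn {X X' Y Y' : E → WithZero G} {s : Set E}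
    (hX : supp X ∩ supp Y ⊆ s) (hX' : supp X' ∩ supp Y' ⊆ s) (h : ∀ e ∈ s, X e * Y e = X' e * Y' e) :
    pairing X Y = pairing X' Y' := by
  classical
  rw [pairing_eq_sum (s := s.toFinset) (by simpa using hX),
    pairing_eq_sum (s := s.toFinset) (by simpa using hX')]
  exact Finset.sum_congr rfl fun e he => by rw [h e (by simpa using he)]

namespace Involution

variable (τ : F.Involution)

@[simp] theorem conj_zero : τ.conj 0 = 0 := map_zero _

theorem conj_mul (a b : WithZero G) : τ.conj (a * b) = τ.conj a * τ.conj b := map_mul _ _ _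

theorem conj_coe (g : G) : τ.conj g = (τ.toHom g : G) := rfl

@[simp] theorem conj_conj (a : WithZero G) : τ.conj (τ.conj a) = a := by
  induction a with
  | zero => simp
  | coe g => rw [conj_coe, conj_coe, τ.involutive]

theorem conj_ne_zero {a : WithZero G} : τ.conj a ≠ 0 ↔ a ≠ 0 := by
  induction a with
  | zero => simp
  | coe g => rw [conj_coe]; simp

theorem supp_conj {E : Type*} (Y : E → WithZero G) : supp (fun e => τ.conj (Y e)) = supp Y := by
  ext e
  exact τ.conj_ne_zero

theorem incl_conj (a : WithZero G) :
    incl (τ.conj a) = MonoidAlgebra.mapDomain τ.toHom (incl a) := by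
  induction a with
  | zero => simp
  | coe g => rw [conj_coe, incl_coe, incl_coe, MonoidAlgebra.mapDomain_single]

end Involution

theorem orthogonal_iff (τ : F.Involution) (X Y : E → WithZero G) :
    F.Orthogonal τ X Y ↔ pairing X (fun e => τ.conj (Y e)) ∈ F.null := Iff.rfl

/-- Applying the involution to the null sum moves the conjugation to the other factor. -/
theorem orthogonal_comm (τ : F.Involution) {X Y : E → WithZero G} (h : F.Orthogonal τ X Y) :
    F.Orthogonal τ Y X := by
  have := τ.map_null _ h
  have hsum := map_sum (MonoidAlgebra.mapDomainRingHom ℕ τ.toHom)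
    (fun e => incl (X e * τ.conj (Y e))) Finset.univ
  simp only [MonoidAlgebra.mapDomainRingHom_apply] at hsum
  rw [hsum] at this
  simp only [← Involution.incl_conj, Involution.conj_mul, Involution.conj_conj] at this
  simpa only [Orthogonal, mul_comm] using this

theorem orthogonal_iff' (τ : F.Involution) (X Y : E → WithZero G) :
    F.Orthogonal τ Y X ↔ pairing X (fun e => τ.conj (Y e)) ∈ F.null :=
  ⟨fun h => orthogonal_comm τ h, fun h => orthogonal_comm τ h⟩

end Tract

/-! ### Signatures: the underlying matroid and its minors -/

namespace Tract

open Set Matroid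

/-- `C` is the set of `F`-circuits of a weak `F`-matroid with underlying matroid `M`. The pair
`X, Y` is subject to elimination when the union of the supports has nullity at most two. -/
structure IsSignature {G : Type*} [CommGroup G] (F : Tract G) {E : Type*} (M : Matroid E)
    (C : Set (E → WithZero G)) : Prop where
  isCircuit : ∀ X ∈ C, M.IsCircuit (supp X)
  exists_supp_eq : ∀ S, M.IsCircuit S → ∃ X ∈ C, supp X = S
  scale_mem : ∀ X ∈ C, ∀ α : G, scale α X ∈ C
  eq_scale : ∀ X ∈ C, ∀ Y ∈ C, supp X = supp Y → ∃ α : G, X = scale α Y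
  elimination : ∀ X ∈ C, ∀ Y ∈ C, supp X ≠ supp Y →
    ∀ x y, M.Indep ((supp X ∪ supp Y) \ {x, y}) → ∀ e, X e = F.neg (Y e) → X e ≠ 0 →
      ∃ Z ∈ C, Z e = 0 ∧ ∀ f, incl (X f) + incl (Y f) + incl (F.neg (Z f)) ∈ F.null

variable {G : Type*} [CommGroup G] {F : Tract G} {E : Type*}

theorem supp_subset_of_elimination {X Y Z : E → WithZero G}
    (h : ∀ f, incl (X f) + incl (Y f) + incl (F.neg (Z f)) ∈ F.null) :
    supp Z ⊆ supp X ∪ supp Y := by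
  intro f hf
  by_contra hn
  have hX : X f = 0 := by_contra fun h => hn (Or.inl h)
  have hY : Y f = 0 := by_contra fun h => hn (Or.inr h)
  have := h f
  rw [hX, hY, incl_zero, zero_add, zero_add, incl_mem_null_iff, neg_eq_zero] at this
  exact hf this

/-- Two elements of `C` can be rescaled so that they cancel at a common element of the supports. -/
theorem IsSignature.exists_scale_eq_neg {M : Matroid E} {C : Set (E → WithZero G)}
    (hC : F.IsSignature M C) {X Y : E → WithZero G} (hY : Y ∈ C) {e : E}
    (hXe : X e ≠ 0) (hYe : Y e ≠ 0) :
    ∃ Y' ∈ C, supp Y' = supp Y ∧ X e = F.neg (Y' e) ∧ ∃ α : G, Y' = scale α Y := by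
  obtain ⟨α, hα⟩ := exists_coe_eq hYe (mt neg_eq_zero.1 hXe : F.neg (X e) ≠ 0)
  exact ⟨scale α Y, hC.scale_mem Y hY α, supp_scale _ _, by simp only [scale, hα, neg_neg], α, rfl⟩

/-- Elimination of supports is given only for modular pairs. The general case is by induction on the
size of A ∪ B: if the pair is not modular, two distinct members have a smaller union, and either one
of them misses e or the induction hypothesis applies to them. -/
theorem IsWeakCircuitSet.exists_isSignature [Finite E] {C : Set (E → WithZero G)}
    (hC : F.IsWeakCircuitSet C) : ∃ M : Matroid E, M.E = univ ∧ F.IsSignature M C := by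
  have hanti : ∀ A ∈ supports C, ∀ B ∈ supports C, A ⊆ B → A = B := by
    rintro _ ⟨X, hX, rfl⟩ _ ⟨Y, hY, rfl⟩ h
    obtain ⟨α, rfl⟩ := hC.incomparable X hX Y hY h
    exact supp_scale α Y
  have helim : ∀ n : ℕ, ∀ A ∈ supports C, ∀ B ∈ supports C, (A ∪ B).ncard ≤ n → A ≠ B →
      ∀ e ∈ A ∩ B, ∃ Z ∈ supports C, Z ⊆ (A ∪ B) \ {e} := by
    intro n
    induction n with
    | zero =>
      intro A _ B _ hn _ e he
      rw [Nat.le_zero, ncard_eq_zero] at hn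
      exact absurd (hn ▸ Or.inl he.1 : e ∈ (∅ : Set E)) (notMem_empty e)
    | succ n ih =>
      intro A hA B hB hn hAB e he
      by_cases hmod : IsModularPair (supports C) A B
      · obtain ⟨X, hX, rfl⟩ := hA
        obtain ⟨Y, hY, rfl⟩ := hB
        obtain ⟨α, hα⟩ := exists_coe_eq (he.2 : Y e ≠ 0)
          (mt neg_eq_zero.1 he.1 : F.neg (X e) ≠ 0)
        obtain ⟨Z, hZ, hZe, hZf⟩ := hC.modular_elimination X hX (scale α Y)
          (hC.smul_mem Y hY α) (by rwa [supp_scale]) e (by simp only [scale, hα, neg_neg]) he.1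
        refine ⟨supp Z, ⟨Z, hZ, rfl⟩, fun f hf => ⟨?_, ?_⟩⟩
        · simpa using supp_subset_of_elimination hZf hf
        · rintro rfl
          exact hf hZe
      · have : ∃ A' ∈ supports C, ∃ B' ∈ supports C, A' ≠ B' ∧ A' ∪ B' ⊂ A ∪ B := by
          by_contra h
          exact hmod ⟨hA, hB, hAB, fun A' hA' B' hB' hne hss => h ⟨A', hA', B', hB', hne, hss⟩⟩
        obtain ⟨A', hA', B', hB', hne, hss⟩ := this
        by_cases heA : e ∈ A'
        · by_cases heB : e ∈ B'
          · have hlt := ncard_lt_ncard hss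
            obtain ⟨Z, hZ, hZs⟩ := ih A' hA' B' hB' (by omega) hne e ⟨heA, heB⟩
            exact ⟨Z, hZ, hZs.trans (sdiff_subset_sdiff_left hss.subset)⟩
          · refine ⟨B', hB', fun z hz => ⟨hss.subset (Or.inr hz), ?_⟩⟩
            rintro rfl
            exact heB hz
        · refine ⟨A', hA', fun z hz => ⟨hss.subset (Or.inl hz), ?_⟩⟩
          rintro rfl
          exact heA hz
  obtain ⟨M, hME, hM⟩ := exists_isCircuit_iff_of_elimination (supports C) (by
    rintro ⟨X, hX, h⟩
    refine hC.zero_notMem ?_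
    have : X = 0 := funext fun e => notMem_supp.1 (by rw [h]; exact notMem_empty e)
    rwa [← this]) hanti (fun A hA B hB => helim _ A hA B hB le_rfl)
  refine ⟨M, hME, fun X hX => (hM _).2 ⟨X, hX, rfl⟩, fun S hS => (hM S).1 hS, hC.smul_mem,
    fun X hX Y hY h => hC.incomparable X hX Y hY h.subset, ?_⟩
  -- Nullity at most two implies modularity: a smaller union of two circuits misses some z in X or
  -- Y, and the circuits avoiding z coincide.
  intro X hX Y hY hne x y hind e he he0
  refine hC.modular_elimination X hX Y hY ⟨⟨X, hX, rfl⟩, ⟨Y, hY, rfl⟩, hne, ?_⟩ e he he0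
  intro A hA B hB hAB hss
  obtain ⟨z, hz, hzn⟩ := exists_of_ssubset hss
  have hsub : ∀ D, D ⊆ A ∪ B → D ⊆ (supp X ∪ supp Y) \ {z} := fun D hD w hw =>
    ⟨hss.subset (hD hw), by rintro rfl; exact hzn (hD hw)⟩
  rcases hz with hz | hz
  · exact hAB (((hM _).2 ⟨X, hX, rfl⟩ : M.IsCircuit (supp X)).eq_of_indep_sdiff_pair
      ((hM A).2 hA) ((hM B).2 hB) subset_union_left hind hz
      (hsub A subset_union_left) (hsub B subset_union_right))
  · exact hAB (((hM _).2 ⟨Y, hY, rfl⟩ : M.IsCircuit (supp Y)).eq_of_indep_sdiff_pair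
      ((hM A).2 hA) ((hM B).2 hB) subset_union_right hind hz
      (hsub A subset_union_left) (hsub B subset_union_right))

namespace IsSignature

variable {M : Matroid E} {C : Set (E → WithZero G)}

/-- Elements of a signature with the same inclusion-minimal trace outside `A` are proportional
outside `A`. -/
theorem exists_eq_scale_off [Finite E] (hC : F.IsSignature M C) {A S : Set E} (hS : S.Nonempty)
    (hmin : ∀ Z, M.IsCircuit Z → (Z \ A).Nonempty → Z \ A ⊆ S → Z \ A = S) :
    ∀ X ∈ C, ∀ Y ∈ C, supp X \ A = S → supp Y \ A = S →
      ∃ α : G, ∀ f ∉ A, X f = α * Y f := by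
  suffices h : ∀ n : ℕ, ∀ X ∈ C, ∀ Y ∈ C, (supp X ∪ supp Y).ncard ≤ n → supp X \ A = S →
      supp Y \ A = S → ∃ α : G, ∀ f ∉ A, X f = α * Y f from
    fun X hX Y hY => h _ X hX Y hY le_rfl
  obtain ⟨e, heS⟩ := hS
  intro n
  induction n with
  | zero =>
    intro X _ Y _ hn hXS _
    rw [Nat.le_zero, ncard_eq_zero] at hn
    rw [← hXS] at heS
    exact absurd (hn ▸ Or.inl heS.1 : e ∈ (∅ : Set E)) (notMem_empty e)
  | succ n ih =>
    intro X hX Y hY hn hXS hYS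
    have heX : e ∈ supp X \ A := by rwa [hXS]
    have heY : e ∈ supp Y \ A := by rwa [hYS]
    have hXc := hC.isCircuit X hX
    have hYc := hC.isCircuit Y hY
    by_cases hXY : supp X = supp Y
    · obtain ⟨α, rfl⟩ := hC.eq_scale X hX Y hY hXY
      exact ⟨α, fun f _ => rfl⟩
    by_cases hmod : ∃ x y, M.Indep ((supp X ∪ supp Y) \ {x, y})
    · obtain ⟨x, y, hxy⟩ := hmod
      obtain ⟨Y', hY', hsupp, hXe, α, rfl⟩ := hC.exists_scale_eq_neg hY heX.1 heY.1
      obtain ⟨Z, hZ, hZe, hZf⟩ := hC.elimination X hX _ hY' (by rwa [hsupp]) x y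
        (by rwa [hsupp]) e hXe heX.1
      -- Z misses e ∈ S, so minimality of S empties its trace off A; hence X and the rescaled Y
      -- cancel there.
      have hZA : supp Z \ A = ∅ := by
        by_contra hne
        have hsub : supp Z \ A ⊆ S := by
          intro f hf
          rcases supp_subset_of_elimination hZf hf.1 with h | h
          · rw [← hXS]; exact ⟨h, hf.2⟩
          · rw [← hYS]; exact ⟨by rwa [hsupp] at h, hf.2⟩
        have := hmin _ (hC.isCircuit Z hZ) (nonempty_iff_ne_empty.2 hne) hsub
        rw [← this] at heS
        exact heS.1 hZe
      refine ⟨F.eps * α, fun f hf => ?_⟩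
      have hZ0 : Z f = 0 := by
        by_contra h
        exact absurd (hZA ▸ ⟨h, hf⟩ : f ∈ (∅ : Set E)) (notMem_empty f)
      have := hZf f
      rw [hZ0, neg_zero, incl_zero, add_zero, incl_add_incl_mem_iff, ← eq_neg_iff] at this
      rw [this, WithZero.coe_mul, neg, mul_assoc]
    -- In higher nullity, interpolate a circuit through e that avoids some x in X \ Y and some y in
    -- Y \ X. Its unions with X and with Y are smaller, and the two ratios compose.
    · have hmod' : ∀ x y, ¬ M.Indep ((supp X ∪ supp Y) \ {x, y}) :=
        fun x y h => hmod ⟨x, y, h⟩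
      have hnss : ¬ supp X ⊆ supp Y := fun h => hXY (hXc.eq_of_subset_isCircuit hYc h)
      obtain ⟨x, hxX, hxY⟩ := not_subset.1 hnss
      have hsubE : (supp X ∪ supp Y) \ {x, e} ⊆ M.E :=
        sdiff_subset.trans (union_subset hXc.subset_ground hYc.subset_ground)
      obtain ⟨D, hD, hDc⟩ := ((not_indep_iff hsubE).1 (hmod' x e)).exists_isCircuit_subset
      have hxD : x ∉ D := fun h => (hD h).2 (Or.inl rfl)
      have heD : e ∉ D := fun h => (hD h).2 (Or.inr rfl)
      have hDX : ¬ D ⊆ supp X := fun h => hxD (hDc.eq_of_subset_isCircuit hXc h ▸ hxX)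
      obtain ⟨y, hyD, hyX⟩ := not_subset.1 hDX
      have hyY : y ∈ supp Y := (hD hyD).1.resolve_left hyX
      obtain ⟨T, hT, hTc, heT⟩ := hYc.strong_elimination hDc hyY hyD heY.1 heD
      have hTXY : T ⊆ supp X ∪ supp Y := by
        intro z hz
        rcases (hT hz).1 with h | h
        exacts [Or.inr h, (hD h).1]
      have hyT : y ∉ T := fun h => (hT h).2 rfl
      have hxT : x ∉ T := by
        intro h
        rcases (hT h).1 with h | h
        exacts [hxY h, hxD h]
      obtain ⟨W, hW, rfl⟩ := hC.exists_supp_eq T hTc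
      have hWS : supp W \ A = S := by
        refine hmin _ hTc ⟨e, heT, heX.2⟩ fun f hf => ?_
        rcases hTXY hf.1 with h | h
        · rw [← hXS]; exact ⟨h, hf.2⟩
        · rw [← hYS]; exact ⟨h, hf.2⟩
      have h1 : (supp X ∪ supp W).ncard < (supp X ∪ supp Y).ncard := by
        refine ncard_lt_ncard ⟨union_subset subset_union_left hTXY, fun h => ?_⟩
        rcases h (Or.inr hyY) with h | h
        exacts [hyX h, hyT h]
      have h2 : (supp W ∪ supp Y).ncard < (supp X ∪ supp Y).ncard := by
        refine ncard_lt_ncard ⟨union_subset hTXY subset_union_right, fun h => ?_⟩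
        rcases h (Or.inl hxX) with h | h
        exacts [hxT h, hxY h]
      obtain ⟨α, hα⟩ := ih X hX W hW (by omega) hXS hWS
      obtain ⟨β, hβ⟩ := ih W hW Y hY (by omega) hWS hYS
      exact ⟨α * β, fun f hf => by rw [hα f hf, hβ f hf, WithZero.coe_mul, mul_assoc]⟩

/-- The deletion of `B`. -/
theorem delete (hC : F.IsSignature M C) (B : Set E) :
    F.IsSignature (M ＼ B) {X ∈ C | Disjoint (supp X) B} where
  isCircuit X hX := delete_isCircuit_iff.2 ⟨hC.isCircuit X hX.1, hX.2⟩
  exists_supp_eq S hS := by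
    obtain ⟨hS, hSB⟩ := delete_isCircuit_iff.1 hS
    obtain ⟨X, hX, rfl⟩ := hC.exists_supp_eq S hS
    exact ⟨X, ⟨hX, hSB⟩, rfl⟩
  scale_mem X hX α := ⟨hC.scale_mem X hX.1 α, by rw [supp_scale]; exact hX.2⟩
  eq_scale X hX Y hY h := hC.eq_scale X hX.1 Y hY.1 h
  elimination X hX Y hY hne x y hxy e he he0 := by
    obtain ⟨Z, hZ, hZe, hZf⟩ := hC.elimination X hX.1 Y hY.1 hne x y hxy.of_delete e he he0
    exact ⟨Z, ⟨hZ, (hX.2.union_left hY.2).mono_left (supp_subset_of_elimination hZf)⟩, hZe, hZf⟩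

/-- The contraction of an independent set `A`. -/
theorem contract [Finite E] (hC : F.IsSignature M C) {A : Set E} (hA : M.Indep A) :
    F.IsSignature (M ／ A)
      {Y | ∃ X ∈ C, (M ／ A).IsCircuit (supp X \ A) ∧ Y = Aᶜ.indicator X} := by
  have hex : ∀ S, (M ／ A).IsCircuit S → ∃ X ∈ C, supp X ⊆ S ∪ A ∧ supp X \ A = S := by
    intro S hS
    obtain ⟨T, hT, hST, hTS⟩ := hS.exists_subset_isCircuit_of_contract
    obtain ⟨X, hX, rfl⟩ := hC.exists_supp_eq T hT
    have hSA : Disjoint S A := (subset_sdiff.1 hS.subset_ground).2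
    refine ⟨X, hX, hTS, subset_antisymm ?_ (subset_sdiff.2 ⟨hST, hSA⟩)⟩
    exact fun z hz => (hTS hz.1).resolve_right hz.2
  have hprop : ∀ X ∈ C, ∀ Y ∈ C, (M ／ A).IsCircuit (supp X \ A) → supp X \ A = supp Y \ A →
      ∃ α : G, ∀ f ∉ A, X f = α * Y f := by
    intro X hX Y hY hXA hXY
    refine hC.exists_eq_scale_off hXA.nonempty ?_ X hX Y hY rfl hXY.symm
    intro Z hZ hne hsub
    exact hXA.eq_of_dep_subset (hZ.contract_dep_of_not_subset (sdiff_nonempty.1 hne)) hsub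
  refine ⟨?_, ?_, ?_, ?_, ?_⟩
  · rintro _ ⟨X, hX, hXA, rfl⟩
    rwa [supp_indicator]
  · intro S hS
    obtain ⟨X, hX, -, rfl⟩ := hex S hS
    exact ⟨_, ⟨X, hX, hS, rfl⟩, supp_indicator _ _⟩
  · rintro _ ⟨X, hX, hXA, rfl⟩ α
    refine ⟨scale α X, hC.scale_mem X hX α, by rwa [supp_scale], ?_⟩
    ext f
    by_cases hf : f ∈ A <;> simp [scale, hf]
  · rintro _ ⟨X, hX, hXA, rfl⟩ _ ⟨Y, hY, hYA, rfl⟩ h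
    rw [supp_indicator, supp_indicator] at h
    obtain ⟨α, hα⟩ := hprop X hX Y hY hXA h
    refine ⟨α, ?_⟩
    ext f
    by_cases hf : f ∈ A
    · simp [hf]
    · simp [hf, hα f hf]
  · rintro _ ⟨X₀, hX₀, hX₀A, rfl⟩ _ ⟨Y₀, hY₀, hY₀A, rfl⟩ hne x y hxy e he he0
    rw [supp_indicator, supp_indicator] at hne hxy
    have lift : ∀ X₀ ∈ C, (M ／ A).IsCircuit (supp X₀ \ A) →
        ∃ X ∈ C, supp X ⊆ supp X₀ ∪ A ∧ supp X \ A = supp X₀ \ A ∧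
          Aᶜ.indicator X₀ = Aᶜ.indicator X := by
      intro X₀ hX₀ hX₀A
      obtain ⟨X₁, hX₁, hs, hX₁A⟩ := hex _ hX₀A
      obtain ⟨α, hα⟩ := hprop X₀ hX₀ X₁ hX₁ hX₀A hX₁A.symm
      refine ⟨scale α X₁, hC.scale_mem _ hX₁ α, ?_, by rw [supp_scale, hX₁A], ?_⟩
      · rw [supp_scale]
        exact hs.trans (by rw [sdiff_union_self])
      · ext f
        by_cases hf : f ∈ A
        · simp [hf]
        · simp [hf, hα f hf]
    obtain ⟨X, hX, hXs, hXA, hXe⟩ := lift X₀ hX₀ hX₀A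
    obtain ⟨Y, hY, hYs, hYA, hYe⟩ := lift Y₀ hY₀ hY₀A
    rw [hXe, hYe] at he
    rw [hXe] at he0
    rw [hXe, hYe]
    rw [← hXA, ← hYA] at hne hxy
    rw [← hXA] at hX₀A
    rw [← hYA] at hY₀A
    clear hXs hYs hXA hYA hXe hYe
    have heA : e ∉ A := fun h => he0 (by simp [h])
    simp only [indicator_of_mem (mem_compl heA)] at he he0
    -- As A is independent, adding it back keeps the nullity in M at most two.
    have hW : M.Indep ((supp X ∪ supp Y ∪ A) \ {x, y}) := by
      refine (hA.contract_indep_iff.1 hxy).2.subset fun z hz => ?_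
      by_cases hzA : z ∈ A
      · exact Or.inr hzA
      · rcases hz.1 with (h | h) | h
        exacts [Or.inl ⟨Or.inl ⟨h, hzA⟩, hz.2⟩, Or.inl ⟨Or.inr ⟨h, hzA⟩, hz.2⟩, (hzA h).elim]
    obtain ⟨Z, hZ, hZe, hZf⟩ := hC.elimination X hX Y hY (fun h => hne (by rw [h])) x y
      (hW.subset (sdiff_subset_sdiff_left subset_union_left)) e he he0
    have hZs := supp_subset_of_elimination hZf
    have hZc := hC.isCircuit Z hZ
    -- The trace of Z must be a circuit of the contraction, not merely dependent: a circuit inside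
    -- it lifts to a circuit of M avoiding e, which equals the support of Z because the nullity is
    -- at most two.
    have hdep : (M ／ A).Dep (supp Z \ A) :=
      hZc.contract_dep_of_not_subset fun h => hZc.not_indep (hA.subset h)
    obtain ⟨S, hSZ, hS⟩ := hdep.exists_isCircuit_subset
    obtain ⟨T, hT, hTS, rfl⟩ := hex S hS
    have hsub : ∀ D ⊆ supp Z ∪ A, D ⊆ (supp X ∪ supp Y ∪ A) \ {e} := by
      intro D hD z hz
      rcases hD hz with h | h
      · exact ⟨Or.inl (hZs h), by rintro rfl; exact h hZe⟩
      · exact ⟨Or.inr h, by rintro rfl; exact heA h⟩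
    have hTZ : supp T = supp Z := (hC.isCircuit X hX).eq_of_indep_sdiff_pair (hC.isCircuit T hT) hZc
      (subset_union_left.trans subset_union_left) hW he0 (hsub _ (hTS.trans
        (union_subset_union_left _ (hSZ.trans sdiff_subset)))) (hsub _ subset_union_left)
    refine ⟨_, ⟨Z, hZ, by rwa [← hTZ], rfl⟩, by simp [hZe], fun f => ?_⟩
    by_cases hf : f ∈ A
    · simpa [hf] using F.zero_mem
    · simpa [hf] using hZf f

end IsSignature

end Tract

/-! ### Vectors on cocircuits and small intersections -/

namespace Tract

open Set Matroid

/-- `Y` is supported on a cocircuit of `M` and it is orthogonal to the elements of `C` whose support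
meets this cocircuit in two elements. -/
structure IsCocircuitVector {G : Type*} [CommGroup G] (F : Tract G) {E : Type*} [Fintype E]
    (M : Matroid E) (C : Set (E → WithZero G)) (Y : E → WithZero G) : Prop where
  isCocircuit : M.IsCocircuit (supp Y)
  pairing_mem : ∀ X ∈ C, ∀ a b, a ≠ b → supp X ∩ supp Y = {a, b} → pairing X Y ∈ F.null

variable {G : Type*} [CommGroup G] {F : Tract G} {E : Type*} {M : Matroid E}
  {C : Set (E → WithZero G)}

theorem eq_of_add_incl_neg_mem {a z : WithZero G} (h : incl a + incl (F.neg z) ∈ F.null) :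
    z = a :=
  neg_inj.1 (incl_add_incl_mem_iff.1 h)

/-- A circuit and a cocircuit never share exactly one element. This gives the minimality that
`exists_eq_scale_off` asks for off the complement of a cocircuit. -/
theorem _root_.Matroid.IsCircuit.inter_isCocircuit_eq_pair {Z K : Set E} {a b : E}
    (hZ : M.IsCircuit Z) (hK : M.IsCocircuit K) (hne : (Z ∩ K).Nonempty) (hab : Z ∩ K ⊆ {a, b}) :
    Z ∩ K = {a, b} := by
  rcases subset_pair_iff_eq.1 hab with h | h | h | h
  · exact absurd h hne.ne_empty
  · exact absurd h (hZ.inter_isCocircuit_ne_singleton hK)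
  · exact absurd h (hZ.inter_isCocircuit_ne_singleton hK)
  · exact h

namespace IsSignature

variable [Fintype E]

/-- The two circuits are proportional on the support of Y, so one test circuit per two-element trace
suffices. -/
theorem pairing_mem_iff_of_inter_eq_pair (hC : F.IsSignature M C) {X X' Y : E → WithZero G}
    (hX : X ∈ C) (hX' : X' ∈ C) (hY : M.IsCocircuit (supp Y)) {a b : E}
    (h : supp X ∩ supp Y = {a, b}) (h' : supp X' ∩ supp Y = {a, b}) :
    pairing X Y ∈ F.null ↔ pairing X' Y ∈ F.null := by
  have hco : ∀ Z : Set E, Z \ (supp Y)ᶜ = Z ∩ supp Y := fun Z => by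
    rw [sdiff_eq, compl_compl]
  obtain ⟨α, hα⟩ := hC.exists_eq_scale_off (A := (supp Y)ᶜ) (S := {a, b}) ⟨a, by simp⟩
    (fun Z hZ hne hsub => by
      rw [hco] at *
      exact hZ.inter_isCocircuit_eq_pair hY hne hsub) X hX X' hX' (by rw [hco, h])
    (by rw [hco, h'])
  rw [← pairing_scale_mem_iff (F := F) α X' Y,
    pairing_congr_of_eqOn (X' := scale α X') (Y' := Y) (s := supp Y) inter_subset_right
      inter_subset_right fun e he => by rw [hα e (not_not.2 he)]]

theorem exists_isCocircuitVector (hC : F.IsSignature M C) {K : Set E} (hK : M.IsCocircuit K) :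
    ∃ Y, F.IsCocircuitVector M C Y ∧ supp Y = K := by
  classical
  obtain ⟨I, hI⟩ := M.exists_isBasis (M.E \ K) sdiff_subset
  obtain ⟨e, he⟩ := hK.nonempty
  have hex : ∀ f, ∃ X : E → WithZero G, f ∈ K → f ≠ e →
      X ∈ C ∧ X f = 1 ∧ supp X ⊆ I ∪ {e, f} ∧ supp X ∩ K = {e, f} := by
    intro f
    by_cases hf : f ∈ K ∧ f ≠ e
    · obtain ⟨S, hS, hSI, hSK⟩ := hK.exists_isCircuit_of_isBasis hI he hf.1 hf.2.symm
      obtain ⟨X, hX, rfl⟩ := hC.exists_supp_eq S hS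
      have hfX : f ∈ supp X ∩ K := by rw [hSK]; simp
      obtain ⟨α, hα⟩ := exists_coe_eq (hfX.1 : X f ≠ 0) (one_ne_zero (α := WithZero G))
      exact ⟨scale α X, fun _ _ => ⟨hC.scale_mem X hX α, hα, by rwa [supp_scale],
        by rwa [supp_scale]⟩⟩
    · exact ⟨0, fun h h' => (hf ⟨h, h'⟩).elim⟩
  choose X hX using hex
  -- Y(e) = 1 is a normalisation; as X_f(f) = 1, the other values are forced by orthogonality to
  -- X_f.
  let Y : E → WithZero G := fun f => if f = e then 1 else if f ∈ K then F.neg (X f e) else 0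
  have hYe : Y e = 1 := if_pos rfl
  have hYf : ∀ f ∈ K, f ≠ e → Y f = F.neg (X f e) := fun f hf hfe => by
    simp only [Y, if_neg hfe, if_pos hf]
  have hY : supp Y = K := by
    ext f
    by_cases hfe : f = e
    · subst hfe
      simp [mem_supp, hYe, he]
    · by_cases hf : f ∈ K
      · have : e ∈ supp (X f) ∩ K := by rw [(hX f hf hfe).2.2.2]; simp
        simpa only [mem_supp, hYf f hf hfe, ne_eq, neg_eq_zero, hf, iff_true] using this.1
      · simp [mem_supp, Y, hfe, hf]
  have hYK : M.IsCocircuit (supp Y) := by rwa [hY]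
  have hpair : ∀ f ∈ K, f ≠ e → ∀ Z ∈ C, supp Z ∩ supp Y = {e, f} → pairing Z Y ∈ F.null := by
    intro f hf hfe Z hZ hZK
    obtain ⟨h1, h2, -, h4⟩ := hX f hf hfe
    rw [hC.pairing_mem_iff_of_inter_eq_pair hZ h1 hYK hZK (by rwa [hY]),
      pairing_pair hfe.symm (by rw [hY, h4]), h2, hYf f hf hfe, hYe, one_mul, mul_one]
  refine ⟨Y, ⟨hYK, ?_⟩, hY⟩
  intro Z hZ f g hfg hZfg
  have hfK : f ∈ K := by
    have : f ∈ supp Z ∩ supp Y := by rw [hZfg]; simp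
    rw [← hY]; exact this.2
  have hgK : g ∈ K := by
    have : g ∈ supp Z ∩ supp Y := by rw [hZfg]; simp
    rw [← hY]; exact this.2
  by_cases hfe : f = e
  · subst hfe
    exact hpair g hgK hfg.symm Z hZ hZfg
  by_cases hge : g = e
  · subst hge
    exact hpair f hfK hfg Z hZ (by rw [hZfg, pair_comm])
  obtain ⟨hXf, hXff, hXfI, hXfK⟩ := hX f hfK hfe
  obtain ⟨hXg, hXgg, hXgI, hXgK⟩ := hX g hgK hge
  have hef : e ∈ supp (X f) ∩ K := by rw [hXfK]; simp
  have heg : e ∈ supp (X g) ∩ K := by rw [hXgK]; simp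
  have hgf : g ∉ supp (X f) := fun h => by
    have : g ∈ supp (X f) ∩ K := ⟨h, hgK⟩
    rw [hXfK] at this
    rcases this with h | h
    exacts [hge h, hfg h.symm]
  have hfg' : f ∉ supp (X g) := fun h => by
    have : f ∈ supp (X g) ∩ K := ⟨h, hfK⟩
    rw [hXgK] at this
    rcases this with h | h
    exacts [hfe h, hfg h]
  -- For a pair avoiding e, eliminate e between X_f and X_g. The result has trace {f, g}, with the
  -- value of X_f at f and of the rescaled X_g at g.
  obtain ⟨X', hX', hsupp, hXe, α, rfl⟩ := hC.exists_scale_eq_neg hXg hef.1 heg.1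
  obtain ⟨W, hW, hWe, hWf⟩ := hC.elimination _ hXf _ hX' (fun h => hfg' (by
    rw [hsupp] at h; rw [← h]; exact (by rw [hXfK]; simp : f ∈ supp (X f) ∩ K).1)) f g
    ((hK.insert_isBase hI he).indep.subset (by
      rw [hsupp]
      rintro z ⟨hz | hz, hzn⟩
      · rcases hXfI hz with h | rfl | h
        exacts [Or.inr h, Or.inl rfl, (hzn (Or.inl h)).elim]
      · rcases hXgI hz with h | rfl | h
        exacts [Or.inr h, Or.inl rfl, (hzn (Or.inr h)).elim])) e hXe hef.1
  have hWs := supp_subset_of_elimination hWf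
  have hWfval : W f = 1 := by
    have := hWf f
    rw [notMem_supp.1 (by rwa [hsupp] : f ∉ supp (scale α (X g))), incl_zero, add_zero] at this
    rw [eq_of_add_incl_neg_mem this, hXff]
  have hWgval : W g = α := by
    have := hWf g
    rw [notMem_supp.1 hgf, incl_zero, zero_add] at this
    rw [eq_of_add_incl_neg_mem this, scale, hXgg, mul_one]
  have hWK : supp W ∩ supp Y = {f, g} := by
    refine (hC.isCircuit W hW).inter_isCocircuit_eq_pair hYK
      ⟨f, by rw [mem_supp, hWfval]; exact one_ne_zero, by rwa [hY]⟩ ?_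
    rintro z ⟨hz, hzK⟩
    rw [hY] at hzK
    rcases hWs hz with h | h
    · have : z ∈ supp (X f) ∩ K := ⟨h, hzK⟩
      rw [hXfK] at this
      rcases this with rfl | h
      exacts [(hz hWe).elim, Or.inl h]
    · have : z ∈ supp (X g) ∩ K := ⟨by rwa [hsupp] at h, hzK⟩
      rw [hXgK] at this
      rcases this with rfl | h
      exacts [(hz hWe).elim, Or.inr h]
  rw [hC.pairing_mem_iff_of_inter_eq_pair hZ hW hYK hZfg hWK, pairing_pair hfg hWK.subset, hWfval,
    hWgval, hYf f hfK hfe, hYf g hgK hge, one_mul, neg_neg, mul_neg, hXe]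

/-- Inside a set I ∪ {a, b, c} of nullity at most two, X is up to scaling the elimination of
circuits with traces {a, b} and {b, c}. Multiplying the relation at b by -Y(b) gives the pairing. -/
theorem pairing_mem_of_inter_eq_triple (hC : F.IsSignature M C) {X Y : E → WithZero G}
    (hY : F.IsCocircuitVector M C Y) (hX : X ∈ C) {a b c : E} (hab : a ≠ b) (hac : a ≠ c)
    (hbc : b ≠ c) (h : supp X ∩ supp Y = {a, b, c}) : pairing X Y ∈ F.null := by
  classical
  have hK := hY.isCocircuit
  have haXY : a ∈ supp X ∩ supp Y := by rw [h]; simp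
  have hbXY : b ∈ supp X ∩ supp Y := by rw [h]; simp
  have hcXY : c ∈ supp X ∩ supp Y := by rw [h]; simp
  have hXc := hC.isCircuit X hX
  have hXind : M.Indep (supp X \ supp Y) :=
    hXc.ssubset_indep ⟨sdiff_subset, fun h' => (h' haXY.1).2 haXY.2⟩
  obtain ⟨I, hI, hXI⟩ := hXind.subset_isBasis_of_subset
    (sdiff_subset_sdiff_left hXc.subset_ground) sdiff_subset
  obtain ⟨S₁, hS₁, hS₁I, hS₁K⟩ := hK.exists_isCircuit_of_isBasis hI haXY.2 hbXY.2 hab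
  obtain ⟨S₂, hS₂, hS₂I, hS₂K⟩ := hK.exists_isCircuit_of_isBasis hI hbXY.2 hcXY.2 hbc
  obtain ⟨X₁, hX₁, rfl⟩ := hC.exists_supp_eq S₁ hS₁
  obtain ⟨X₂, hX₂, rfl⟩ := hC.exists_supp_eq S₂ hS₂
  have hc₁ : c ∉ supp X₁ := fun h' => by
    have : c ∈ supp X₁ ∩ supp Y := ⟨h', hcXY.2⟩
    rw [hS₁K] at this
    rcases this with h | h
    exacts [hac h.symm, hbc h.symm]
  have ha₂ : a ∉ supp X₂ := fun h' => by
    have : a ∈ supp X₂ ∩ supp Y := ⟨h', haXY.2⟩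
    rw [hS₂K] at this
    rcases this with h | h
    exacts [hab h, hac h]
  have ha₁ : a ∈ supp X₁ := (by rw [hS₁K]; simp : a ∈ supp X₁ ∩ supp Y).1
  have hWind : M.Indep ((I ∪ {a, b, c}) \ {b, c}) := by
    refine (hK.insert_isBase hI haXY.2).indep.subset ?_
    rintro z ⟨hz | rfl | h', hzn⟩
    exacts [Or.inr hz, Or.inl rfl, (hzn h').elim]
  have hXW : supp X ⊆ I ∪ {a, b, c} := fun z hz => by
    by_cases hzY : z ∈ supp Y
    · exact Or.inr (h ▸ ⟨hz, hzY⟩)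
    · exact Or.inl (hXI ⟨hz, hzY⟩)
  have hX₁W : supp X₁ ⊆ I ∪ {a, b, c} := hS₁I.trans (union_subset_union_right _ (by
    rintro z (rfl | rfl) <;> simp))
  have hX₂W : supp X₂ ⊆ I ∪ {a, b, c} := hS₂I.trans (union_subset_union_right _ (by
    rintro z (rfl | rfl) <;> simp))
  have hnss : ¬ supp X₁ ⊆ supp X := fun h' =>
    hc₁ (hS₁.eq_of_subset_isCircuit hXc h' ▸ hcXY.1)
  -- Eliminating t outside X yields X, the only circuit avoiding t. For the same reason t lies in
  -- X₂, which lacks a and so differs from X.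
  obtain ⟨t, ht₁, htX⟩ := not_subset.1 hnss
  have hXWt : supp X ⊆ (I ∪ {a, b, c}) \ {t} := subset_sdiff_singleton hXW htX
  have ht₂ : t ∈ supp X₂ := by
    by_contra ht₂
    refine ha₂ ?_
    rw [← hS₁.eq_of_indep_sdiff_pair hXc hS₂ hX₁W hWind ht₁ hXWt
      (subset_sdiff_singleton hX₂W ht₂)]
    exact haXY.1
  obtain ⟨X₂', hX₂', hsupp, hX₁t, α, rfl⟩ := hC.exists_scale_eq_neg hX₂ ht₁ ht₂
  obtain ⟨Z, hZ, hZt, hZf⟩ := hC.elimination _ hX₁ _ hX₂' (fun h' => ha₂ (by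
    rw [hsupp] at h'; rwa [← h'])) b c (hWind.subset (by
      rw [hsupp]; exact sdiff_subset_sdiff_left (union_subset hX₁W hX₂W))) t hX₁t ht₁
  have hZs := supp_subset_of_elimination hZf
  rw [hsupp] at hZs
  have hZX : supp X = supp Z := hS₁.eq_of_indep_sdiff_pair hXc (hC.isCircuit Z hZ) hX₁W hWind ht₁
    hXWt (subset_sdiff_singleton (hZs.trans (union_subset hX₁W hX₂W)) (not_not.2 hZt))
  obtain ⟨β, rfl⟩ := hC.eq_scale X hX Z hZ hZX
  rw [pairing_scale_mem_iff]
  have hZa : Z a = X₁ a := by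
    have := hZf a
    rw [notMem_supp.1 (by rwa [hsupp] : a ∉ supp (scale α X₂)), incl_zero, add_zero] at this
    exact eq_of_add_incl_neg_mem this
  have hZc : Z c = scale α X₂ c := by
    have := hZf c
    rw [notMem_supp.1 hc₁, incl_zero, zero_add] at this
    exact eq_of_add_incl_neg_mem this
  have h₁ := (pairing_pair hab hS₁K.subset).1 (hY.pairing_mem X₁ hX₁ a b hab hS₁K)
  have h₂ := (pairing_pair (F := F) (X := scale α X₂) (Y := Y) hbc (by rw [hsupp, hS₂K])).1
    (hY.pairing_mem _ hX₂' b c hbc (by rw [hsupp, hS₂K]))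
  have key := incl_mul_mem (F.neg (Y b)) (hZf b)
  have e₁ : F.neg (Y b) * X₁ b = Z a * Y a := by
    rw [neg_mul, mul_comm, h₁, neg_neg, hZa]
  have e₂ : F.neg (Y b) * scale α X₂ b = Z c * Y c := by
    rw [neg_mul, mul_comm, ← h₂, hZc]
  have e₃ : F.neg (Y b) * F.neg (Z b) = Z b * Y b := by
    rw [neg_mul, mul_neg, neg_neg, mul_comm]
  rw [mul_add, mul_add, ← incl_mul, ← incl_mul, ← incl_mul, e₁, e₂, e₃] at key
  rw [pairing_eq_sum (s := {a, b, c}) (by rw [← supp_scale β Z, h]; simp),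
    Finset.sum_insert (by simp [hab, hac]), Finset.sum_pair hbc]
  convert! key using 1
  abel

/-- Any two points of the cocircuit are the trace of a circuit, which fixes the ratio of the
coordinates. -/
theorem exists_eq_scale_of_supp_eq (hC : F.IsSignature M C) {Y Y' : E → WithZero G}
    (hY : F.IsCocircuitVector M C Y) (hY' : F.IsCocircuitVector M C Y') (h : supp Y' = supp Y) :
    ∃ α : G, Y' = scale α Y := by
  obtain ⟨e, he⟩ := hY.isCocircuit.nonempty
  obtain ⟨α, hα⟩ := exists_coe_eq (he : Y e ≠ 0) (h ▸ he : e ∈ supp Y')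
  refine ⟨α, funext fun f => ?_⟩
  by_cases hf : f ∈ supp Y
  · by_cases hfe : e = f
    · rw [← hfe, scale, hα]
    obtain ⟨S, hS, hSK⟩ := hY.isCocircuit.exists_isCircuit_inter_eq_pair he hf hfe
    obtain ⟨X, hX, rfl⟩ := hC.exists_supp_eq S hS
    have h₁ := (pairing_pair hfe hSK.subset).1 (hY.pairing_mem X hX e f hfe hSK)
    have h₂ := (pairing_pair hfe (by rw [h, hSK])).1
      (hY'.pairing_mem X hX e f hfe (by rw [h, hSK]))
    have hXf : X f ≠ 0 := (by rw [hSK]; simp : f ∈ supp X ∩ supp Y).1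
    refine mul_left_cancel₀ hXf ?_
    rw [h₂, ← hα, scale, mul_left_comm, mul_left_comm (X f), h₁, mul_neg]
  · rw [scale, notMem_supp.1 hf, mul_zero]
    exact notMem_supp.1 (h ▸ hf)

end IsSignature

end Tract

/-! ### Perfect tracts: orthogonality of circuits and cocircuits -/

namespace Tract

open Set Matroid

section

variable {G : Type*} [CommGroup G] {F : Tract G} {E : Type*} {M : Matroid E}
  {C : Set (E → WithZero G)}

theorem _root_.Matroid.IsCircuit.exists_isCircuit_avoiding {k : ℕ} {X : Set E}
    {Xs : Fin k → Set E} {e : Fin k → E} {x : E} (hX : M.IsCircuit X)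
    (hXs : ∀ i, M.IsCircuit (Xs i)) (he : ∀ i, e i ∈ X ∩ Xs i ∧ ∀ j, j ≠ i → e i ∉ Xs j)
    (hx : x ∈ X) (hxs : x ∉ ⋃ i, Xs i) :
    ∃ Z, M.IsCircuit Z ∧ x ∈ Z ∧ Z ⊆ (X ∪ ⋃ i, Xs i) \ range e := by
  obtain ⟨Z, hZs, hZ, hxZ⟩ := hX.strong_multi_elimination e Xs x hXs (fun i => (he i).1.1)
    (fun i => (he i).1.2) (fun i j h => by
      by_contra hij
      exact (he i).2 j (Ne.symm hij) h) hx (by simpa using hxs)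
  exact ⟨Z, hZ, hxZ, hZs⟩

namespace IsSignature

/-- A signature of a matroid of nullity at most two is strong. -/
theorem isStrongCircuitSet_of_indep [Finite E] (hC : F.IsSignature M C) {s t : E}
    (hM : M.Indep (M.E \ {s, t})) : F.IsStrongCircuitSet C where
  zero_notMem h := by
    obtain ⟨e, he⟩ := (hC.isCircuit 0 h).nonempty
    exact he rfl
  smul_mem := hC.scale_mem
  incomparable X hX Y hY h :=
    hC.eq_scale X hX Y hY ((hC.isCircuit X hX).eq_of_subset_isCircuit (hC.isCircuit Y hY) h)
  strong_modular_elimination := by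
    intro k Xs X e hXs hX _ hnss he hXe
    have hXc := hC.isCircuit X hX
    have hXsc := fun i => hC.isCircuit (Xs i) (hXs i)
    obtain ⟨x, hx, hxs⟩ := not_subset.1 hnss
    match k with
    | 0 =>
      refine ⟨X, hX, fun i => i.elim0, fun f => ?_⟩
      rw [Finset.univ_eq_empty, Finset.sum_empty, zero_add]
      exact incl_add_incl_neg_mem _
    | 1 =>
      have hne : supp X ≠ supp (Xs 0) := fun h => hxs (mem_iUnion.2 ⟨0, h ▸ hx⟩)
      obtain ⟨Z, hZ, hZe, hZf⟩ := hC.elimination X hX (Xs 0) (hXs 0) hne s t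
        (hM.subset (sdiff_subset_sdiff_left (union_subset hXc.subset_ground
          (hXsc 0).subset_ground))) (e 0) (hXe 0) (he 0).1.1
      refine ⟨Z, hZ, fun i => by rwa [Subsingleton.elim i 0], fun f => ?_⟩
      rw [Fin.sum_univ_one, add_comm (incl (Xs 0 f))]
      exact hZf f
    -- Impossible: Z and `Xs 1` both avoid `e 0`, hence coincide, yet `e 1` lies only in the latter.
    | k + 2 =>
      exfalso
      obtain ⟨Z, hZ, -, hZs⟩ := hXc.exists_isCircuit_avoiding hXsc he hx hxs
      have h01 : (0 : Fin (k + 2)) ≠ 1 := by simp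
      have h : Z = supp (Xs 1) := (hXsc 0).eq_of_indep_sdiff_pair hZ (hXsc 1)
        (hXsc 0).subset_ground hM (he 0).1.2
        (subset_sdiff_singleton hZ.subset_ground fun h => (hZs h).2 ⟨0, rfl⟩)
        (subset_sdiff_singleton (hXsc 1).subset_ground ((he 0).2 1 h01.symm))
      exact (hZs (h ▸ (he 1).1.2 : e 1 ∈ Z)).2 ⟨1, rfl⟩

/-- Otherwise the support is coindependent within the ground set, so some circuit meets it in one
point, and a single nonzero term is not null. -/
theorem exists_isCocircuit_subset_supp [Fintype E] (hC : F.IsSignature M C) {V : E → WithZero G}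
    (hV : ∀ Z ∈ C, pairing Z V ∈ F.null) (hne : (supp V ∩ M.E).Nonempty) :
    ∃ K ⊆ supp V, M.IsCocircuit K := by
  by_contra hcon
  have hcoind : M.Coindep (supp V ∩ M.E) := coindep_iff_forall_subset_not_isCocircuit.2
    ⟨fun K hK hKc => hcon ⟨K, hK.trans inter_subset_left, hKc⟩, inter_subset_right⟩
  obtain ⟨v, hvV, hvE⟩ := hne
  have hsp := hcoind.compl_spanning
  have hv : v ∈ M.closure (M.E \ (supp V ∩ M.E)) := by rwa [hsp.closure_eq]
  obtain ⟨S, hS, hSc, hvS⟩ := exists_isCircuit_of_mem_closure hv fun h => h.2 ⟨hvV, hvE⟩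
  obtain ⟨Z, hZ, rfl⟩ := hC.exists_supp_eq S hSc
  have h := hV Z hZ
  rw [pairing_eq_sum (s := {v}), Finset.sum_singleton, incl_mem_null_iff] at h
  · exact mul_ne_zero hvS hvV h
  · rintro z ⟨hz, hzV⟩
    rcases hS hz with rfl | h
    · simp
    · exact (h.2 ⟨hzV, h.1⟩).elim

end IsSignature

/-- A cocircuit equal to the ground set would be the only one, but some cocircuit contains a and not
b. -/
theorem _root_.Matroid.IsCocircuit.ssubset_ground_of_indep {K : Set E} {a b : E}
    (hK : M.IsCocircuit K) (hab : a ≠ b) (h : M.Indep {a, b}) : K ⊂ M.E := by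
  refine hK.subset_ground.ssubset_of_ne ?_
  rintro rfl
  obtain ⟨K', hK', hab'⟩ := h.exists_isCocircuit_inter_eq_mem (mem_insert a {b})
  have hKE : K' = M.E := hK'.isCircuit.eq_of_subset_isCircuit hK.isCircuit hK'.subset_ground
  have hb : b ∈ K' ∩ {a, b} := ⟨by rw [hKE]; exact h.subset_ground (by simp), by simp⟩
  rw [hab'] at hb
  exact hab hb.symm

end

variable {G : Type u} [CommGroup G] {F : Tract G} {τ : F.Involution} {E : Type v} [Fintype E]
  {M : Matroid E} {C : Set (E → WithZero G)}

namespace IsSignature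

theorem pairing_mem_of_forall_lt (hF : IsPerfect.{u, v} F τ) (hC : F.IsSignature M C)
    {X Y : E → WithZero G} (hX : X ∈ C) (hY : F.IsCocircuitVector M C Y)
    (hn : 4 ≤ (supp X ∩ supp Y).ncard)
    (hlt : ∀ X' ∈ C, ∀ Y', F.IsCocircuitVector M C Y' →
      (supp X' ∩ supp Y').ncard < (supp X ∩ supp Y).ncard → pairing X' Y' ∈ F.null) :
    pairing X Y ∈ F.null := by
  set T := supp X ∩ supp Y with hT
  have hXc := hC.isCircuit X hX
  have hK := hY.isCocircuit
  -- In the minor on T, {s, t} will be the complement of a base; a and b, available since |T| ≥ 4,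
  -- will be independent, so that cocircuits are proper subsets of T.
  obtain ⟨s, hs, t, ht, hst⟩ := (one_lt_ncard (toFinite _)).1 (by omega : 1 < T.ncard)
  have hTst : 2 ≤ (T \ {s, t}).ncard := by
    have h1 := ncard_pair hst
    have h2 := ncard_sdiff_add_ncard_of_subset (pair_subset hs ht)
    omega
  obtain ⟨a, ha, b, hb, hab⟩ := (one_lt_ncard (toFinite _)).1 (by omega : 1 < (T \ {s, t}).ncard)
  have hXst : M.Indep (supp X \ {s, t}) :=
    hXc.ssubset_indep ⟨sdiff_subset, fun h => (h hs.1).2 (Or.inl rfl)⟩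
  have hsp : M.Spanning (supp X \ {s, t} ∪ M.E \ supp Y) :=
    hK.spanning_of_compl_ssubset ha.1.2 (Or.inl ⟨ha.1.1, ha.2⟩) subset_union_right
      (union_subset hXst.subset_ground sdiff_subset)
  -- P adds to X \ {s, t} only points off Y. Contracting A = P \ Y avoids Y, absorbs X outside T and
  -- makes T \ {s, t} a base of the minor.
  obtain ⟨P, hP, hXP, hPX⟩ := hXst.exists_isBase_subset_spanning hsp subset_union_left
  set A := P \ supp Y with hAdef
  have hAind : M.Indep A := hP.indep.subset sdiff_subset
  have hAT : Disjoint A T := disjoint_left.2 fun z hz hzT => hz.2 hzT.2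
  have hXA : supp X ⊆ T ∪ A := fun z hz => by
    by_cases hzY : z ∈ supp Y
    · exact Or.inl ⟨hz, hzY⟩
    · refine Or.inr ⟨hXP ⟨hz, ?_⟩, hzY⟩
      rintro (rfl | rfl)
      exacts [hzY hs.2, hzY ht.2]
  have hPA : P ⊆ T \ {s, t} ∪ A := fun z hz => by
    by_cases hzY : z ∈ supp Y
    · rcases hPX hz with h | h
      exacts [Or.inl ⟨⟨h.1, hzY⟩, h.2⟩, (h.2 hzY).elim]
    · exact Or.inr ⟨hz, hzY⟩
  have hAP : T \ {s, t} ∪ A ⊆ P := by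
    rintro z (hz | hz)
    exacts [hXP ⟨hz.1.1, hz.2⟩, hz.1]
  have hTE : T ⊆ M.E := inter_subset_left.trans hXc.subset_ground
  set B := M.E \ (T ∪ A) with hB
  have hTB : Disjoint T B := disjoint_left.2 fun z hz hzB => hzB.2 (Or.inl hz)
  set N := M ／ A ＼ B with hN
  have hNE : N.E = T := by
    rw [hN, delete_ground, contract_ground]
    ext z
    refine ⟨fun hz => by_contra fun hzT => hz.2 ⟨hz.1.1, ?_⟩, fun hz =>
      ⟨⟨hTE hz, fun h => hAT.ne_of_mem h hz rfl⟩, fun h => hTB.ne_of_mem hz h rfl⟩⟩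
    rintro (h | h)
    exacts [hzT h, hz.1.2 h]
  have hNind : ∀ I ⊆ T, N.Indep I ↔ M.Indep (I ∪ A) := by
    intro I hI
    rw [hN, delete_indep_iff, hAind.contract_indep_iff]
    have h1 : Disjoint I A := (hAT.mono_right hI).symm
    have h2 : Disjoint I B := hTB.mono_left hI
    tauto
  have hNst : N.Indep (T \ {s, t}) :=
    (hNind _ sdiff_subset).2 (hP.indep.subset hAP)
  have hCN := (hC.contract hAind).delete B
  rw [← hN] at hCN
  set CN : Set (E → WithZero G) := {Z ∈ {Y | ∃ X ∈ C, (M ／ A).IsCircuit (supp X \ A) ∧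
    Y = Aᶜ.indicator X} | Disjoint (supp Z) B} with hCNdef
  have hstrong : F.IsStrongCircuitSet CN :=
    hCN.isStrongCircuitSet_of_indep (s := s) (t := t) (by rwa [hNE])
  -- If T were a circuit, T \ {t} together with A would be independent and strictly contain the base
  -- P.
  have hZT : ∀ Z ∈ CN, supp Z ⊂ T := by
    intro Z hZ
    have hZc := hCN.isCircuit Z hZ
    refine (hNE ▸ hZc.subset_ground).ssubset_of_ne fun h => ?_
    rw [h] at hZc
    have h1 := (hNind _ sdiff_subset).1 (hZc.sdiff_singleton_indep ht)
    have h2 : P = T \ {t} ∪ A := hP.eq_of_subset_indep h1 (hPA.trans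
      (union_subset_union_left _ (sdiff_subset_sdiff_right (by simp))))
    have hsP : s ∈ P := by
      rw [h2]
      exact Or.inl ⟨hs, hst⟩
    rcases hPX hsP with h | h
    exacts [h.2 (Or.inl rfl), h.2 hs.2]
  have hrep : ∀ Z ∈ CN, ∃ Z₀ ∈ C, supp Z₀ ⊆ supp Z ∪ A ∧ ∀ f ∈ T, Z f = Z₀ f := by
    rintro _ ⟨⟨Z₀, hZ₀, -, rfl⟩, -⟩
    refine ⟨Z₀, hZ₀, ?_, fun f hf => ?_⟩
    · rw [supp_indicator, sdiff_union_self]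
      exact subset_union_left
    · exact indicator_of_mem (mem_compl fun h => hAT.ne_of_mem h hf rfl) _
  -- A cocircuit avoiding A meets the lift of Z only inside the support of Z, a proper subset of T,
  -- so the induction hypothesis applies.
  have hpairing : ∀ Z ∈ CN, ∀ Y₀, F.IsCocircuitVector M C Y₀ → Disjoint (supp Y₀) A →
      ∀ Y₁, (∀ f ∈ T, Y₁ f = Y₀ f) → pairing Z Y₁ ∈ F.null := by
    intro Z hZ Y₀ hY₀ hYA Y₁ hY₁
    obtain ⟨Z₀, hZ₀, hZ₀A, hZf⟩ := hrep Z hZ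
    have hsub : supp Z₀ ∩ supp Y₀ ⊆ supp Z := fun z hz =>
      (hZ₀A hz.1).resolve_right fun h => hYA.ne_of_mem hz.2 h rfl
    rw [pairing_congr_of_eqOn (X' := Z₀) (Y' := Y₀) (s := T)
      (inter_subset_left.trans (hZT Z hZ).subset) (hsub.trans (hZT Z hZ).subset)
      fun e he => by rw [hZf e he, hY₁ e he]]
    exact hlt Z₀ hZ₀ Y₀ hY₀ (ncard_lt_ncard (hsub.trans_ssubset (hZT Z hZ)))
  have hX'supp : supp (Aᶜ.indicator X) = T := by
    rw [supp_indicator]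
    refine subset_antisymm (fun z hz => (hXA hz.1).resolve_right hz.2) fun z hz => ?_
    exact ⟨hz.1, fun h => hAT.ne_of_mem h hz rfl⟩
  have hX' : ∀ Y₀ Y₁ : E → WithZero G, Disjoint (supp Y₀) A → (∀ f ∈ T, Y₁ f = Y₀ f) →
      pairing (Aᶜ.indicator X) Y₁ = pairing X Y₀ := by
    intro Y₀ Y₁ hYA hY₁
    refine pairing_congr_of_eqOn (s := T) ?_ ?_ fun e he => ?_
    · rw [hX'supp]; exact inter_subset_left
    · exact fun z hz => (hXA hz.1).resolve_right fun h => hYA.ne_of_mem hz.2 h rfl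
    · rw [hY₁ e he, indicator_of_mem (mem_compl fun h => hAT.ne_of_mem h he rfl)]
  have hYA : Disjoint (supp Y) A := disjoint_left.2 fun z hz hzA => hzA.2 hz
  -- Conjugating Y cancels the involution in the definition of orthogonality.
  have hmain := hF E CN hstrong (Aᶜ.indicator X) (fun e => τ.conj (Y e)) ?vector ?covector
  case covector =>
    intro Z hZ
    rw [orthogonal_iff']
    exact hpairing Z hZ Y hY hYA _ fun f _ => τ.conj_conj _
  case vector =>
    rintro V ⟨⟨hV, hV0⟩, hVmin⟩
    rw [orthogonal_iff]
    set V' : E → WithZero G := fun e => τ.conj (V e) with hV'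
    have hVV' : supp V' = supp V := τ.supp_conj V
    have hV'C : ∀ Z ∈ CN, pairing Z V' ∈ F.null := fun Z hZ =>
      (orthogonal_iff' τ Z V).1 (hV Z hZ)
    -- Vectors live on all of E but the minor lives on T, so V may be supported off T; it is then
    -- trivially orthogonal.
    by_cases hdisj : (supp V' ∩ N.E).Nonempty
    · obtain ⟨K, hKV, hKc⟩ := hCN.exists_isCocircuit_subset_supp hV'C hdisj
      have hKT : K ⊂ T := by
        rw [← hNE]
        exact hKc.ssubset_ground_of_indep hab (hNst.subset (pair_subset ha hb))
      -- K lifts to a cocircuit L of M that avoids A and meets T in K. By minimality of its support,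
      -- V is conjugate to a multiple of the restriction to T of the vector on L.
      have hKd : (M✶ ＼ A ／ B).IsCircuit K := by
        rw [← dual_contract_delete]
        exact hKc
      obtain ⟨L, hL, hKL, hLK⟩ := hKd.exists_subset_isCircuit_of_contract
      obtain ⟨hL, hLA⟩ := delete_isCircuit_iff.1 hL
      obtain ⟨Y₀, hY₀, rfl⟩ := hC.exists_isCocircuitVector (K := L) hL
      have hLT : supp Y₀ ∩ T = K := by
        refine subset_antisymm (fun z hz => (hLK hz.1).resolve_right fun h =>
          hTB.ne_of_mem hz.2 h rfl) fun z hz => ⟨hKL hz, hKT.subset hz⟩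
      have hY₁ : ∀ f ∈ T, T.indicator Y₀ f = Y₀ f := fun f hf => indicator_of_mem hf _
      have hY₁supp : supp (T.indicator Y₀) = K := by
        rw [← compl_compl T, supp_indicator, Set.sdiff_eq, compl_compl, hLT]
      have hY₁C : ∀ Z ∈ CN, pairing Z (T.indicator Y₀) ∈ F.null := fun Z hZ =>
        hpairing Z hZ Y₀ hY₀ hLA _ hY₁
      have hKVeq : K = supp V' := by
        rw [hVV']
        have := hVmin (fun e => τ.conj (T.indicator Y₀ e)) ⟨fun Z hZ => ?_, ?_⟩ ?_
        · rwa [τ.supp_conj, hY₁supp] at this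
        · rw [orthogonal_iff']
          simp only [Involution.conj_conj]
          exact hY₁C Z hZ
        · intro h
          obtain ⟨z, hz⟩ := hKc.nonempty
          rw [← hY₁supp, ← τ.supp_conj, h] at hz
          exact hz rfl
        · rwa [τ.supp_conj, hY₁supp, ← hVV']
      obtain ⟨α, hα⟩ := hCN.exists_eq_scale_of_supp_eq (Y := T.indicator Y₀) (Y' := V')
        ⟨by rwa [hY₁supp], fun Z hZ _ _ _ _ => hY₁C Z hZ⟩
        ⟨by rwa [← hKVeq], fun Z hZ _ _ _ _ => hV'C Z hZ⟩ (by rw [hY₁supp, hKVeq])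
      rw [hα, pairing_comm, pairing_scale_mem_iff, pairing_comm, hX' Y₀ _ hLA hY₁]
      refine hlt X hX Y₀ hY₀ (ncard_lt_ncard (ssubset_of_subset_of_ssubset ?_ hKT))
      rintro z ⟨hzX, hzL⟩
      rw [← hLT]
      exact ⟨hzL, (hXA hzX).resolve_right fun h => hLA.ne_of_mem hzL h rfl⟩
    · refine pairing_mem_of_disjoint ?_
      rw [hX'supp, ← hNE, inter_comm]
      exact not_nonempty_iff_eq_empty.1 hdisj
  rw [orthogonal_iff] at hmain
  simp only [Involution.conj_conj] at hmain
  rwa [hX' Y Y hYA fun _ _ => rfl] at hmain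

/-- Over a perfect tract, all circuits and cocircuits of a weak matroid are orthogonal. -/
theorem pairing_mem (hF : IsPerfect.{u, v} F τ) (hC : F.IsSignature M C)
    {X Y : E → WithZero G} (hX : X ∈ C) (hY : F.IsCocircuitVector M C Y) :
    pairing X Y ∈ F.null := by
  induction hn : (supp X ∩ supp Y).ncard using Nat.strong_induction_on generalizing X Y with
  | _ n ih =>
    match n with
    | 0 => exact pairing_mem_of_disjoint ((ncard_eq_zero).1 hn)
    | 1 =>
      obtain ⟨a, ha⟩ := ncard_eq_one.1 hn
      exact ((hC.isCircuit X hX).inter_isCocircuit_ne_singleton hY.isCocircuit ha).elim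
    | 2 =>
      obtain ⟨a, b, hab, h⟩ := ncard_eq_two.1 hn
      exact hY.pairing_mem X hX a b hab h
    | 3 =>
      obtain ⟨a, b, c, hab, hac, hbc, h⟩ := ncard_eq_three.1 hn
      exact hC.pairing_mem_of_inter_eq_triple hY hX hab hac hbc h
    | n + 4 =>
      exact hC.pairing_mem_of_forall_lt hF hX hY (by omega) fun X' hX' Y' hY' hlt =>
        ih _ (hn ▸ hlt) hX' hY' rfl

end IsSignature

end Tract

/-! ### From orthogonality to strong elimination -/

namespace Tract

open Set Matroid

theorem empty_mem_unions {E : Type*} (S : Set (Set E)) : ∅ ∈ unions S :=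
  ⟨∅, empty_subset _, sUnion_empty.symm⟩

theorem union_mem_unions {E : Type*} {S : Set (Set E)} {A B : Set E} (hA : A ∈ unions S)
    (hB : B ∈ S) : A ∪ B ∈ unions S := by
  obtain ⟨T, hT, rfl⟩ := hA
  exact ⟨insert B T, insert_subset hB hT, by rw [sUnion_insert, union_comm]⟩

/-- If the union `U` of a family of members of `S`, each with a private element, has height at most
one more than the size of the family, then incomparable members of `S` contained in `U` that avoid
all private elements are equal. -/
theorem eq_of_height_le {E : Type*} {S : Set (Set E)} {U : Set E} (hU : U ∈ unions S) {k : ℕ}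
    (hh : Order.height (⟨U, hU⟩ : unions S) ≤ (k + 1 : ℕ)) {A : Fin k → Set E} {e : Fin k → E}
    (hA : ∀ i, A i ∈ S) (hAU : ∀ i, A i ⊆ U) (he : ∀ i, e i ∈ A i ∧ ∀ j, j ≠ i → e i ∉ A j)
    {B D : Set E} (hB : B ∈ S) (hD : D ∈ S) (hBne : B.Nonempty) (hBD : D ⊆ B → D = B)
    (hBU : B ⊆ U \ range e) (hDU : D ⊆ U \ range e) : D = B := by
  by_contra hne
  -- The chain ∅ ⊂ B ⊂ B ∪ D, continued by adding the A i one at a time, is strict because of the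
  -- private elements; its length k + 2 is one too many.
  have key : ∀ j : ℕ, j ≤ k → ∃ V, ∃ hV : V ∈ unions S,
      V ⊆ U ∧ (∀ i : Fin k, j ≤ i → e i ∉ V) ∧
        ((j + 2 : ℕ) : ℕ∞) ≤ Order.height (⟨V, hV⟩ : unions S) := by
    intro j
    induction j with
    | zero =>
      intro _
      have hBm := union_mem_unions (empty_mem_unions S) hB
      rw [empty_union] at hBm
      have h1 : (⟨∅, empty_mem_unions S⟩ : unions S) < ⟨B, hBm⟩ :=
        (empty_ssubset.2 hBne : (∅ : Set E) ⊂ B)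
      have h2 : (⟨B, hBm⟩ : unions S) < ⟨B ∪ D, union_mem_unions hBm hD⟩ := by
        refine (⟨subset_union_left, fun h => hne (hBD fun z hz => h (Or.inr hz))⟩ : B ⊂ B ∪ D)
      refine ⟨B ∪ D, union_mem_unions hBm hD, union_subset (hBU.trans sdiff_subset)
        (hDU.trans sdiff_subset), ?_, ?_⟩
      · rintro i - (h | h)
        exacts [(hBU h).2 ⟨i, rfl⟩, (hDU h).2 ⟨i, rfl⟩]
      · have h3 := Order.height_add_one_le h1
        have h4 := Order.height_add_one_le h2
        calc ((0 + 2 : ℕ) : ℕ∞) = 0 + 1 + 1 := by norm_num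
          _ ≤ Order.height (⟨∅, empty_mem_unions S⟩ : unions S) + 1 + 1 := by gcongr; exact zero_le
          _ ≤ _ := (by gcongr : _ ≤ _ + (1 : ℕ∞)).trans h4
    | succ j ih =>
      intro hj
      obtain ⟨V, hV, hVU, hVe, hVh⟩ := ih (by omega)
      have hlt : (⟨V, hV⟩ : unions S) < ⟨V ∪ A ⟨j, hj⟩, union_mem_unions hV (hA _)⟩ :=
        (⟨subset_union_left, fun h => hVe ⟨j, hj⟩ le_rfl (h (Or.inr (he _).1))⟩ :
          V ⊂ V ∪ A ⟨j, hj⟩)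
      refine ⟨V ∪ A ⟨j, hj⟩, union_mem_unions hV (hA _), union_subset hVU (hAU _), ?_, ?_⟩
      · rintro i hi (h | h)
        · exact hVe i (by omega) h
        · refine (he i).2 ⟨j, hj⟩ (fun h' => ?_) h
          rw [← h'] at hi
          exact absurd hi (by simp)
      · have h3 := Order.height_add_one_le hlt
        calc ((j + 1 + 2 : ℕ) : ℕ∞) = ((j + 2 : ℕ) : ℕ∞) + 1 := by push_cast; ring
          _ ≤ _ := (by gcongr : _ ≤ _ + (1 : ℕ∞)).trans h3
  obtain ⟨V, hV, hVU, -, hVh⟩ := key k le_rfl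
  have h5 : Order.height (⟨V, hV⟩ : unions S) ≤ Order.height (⟨U, hU⟩ : unions S) :=
    Order.height_mono hVU
  have h6 : k + 2 ≤ k + 1 := by exact_mod_cast hVh.trans (h5.trans hh)
  omega

variable {G : Type*} [CommGroup G] {F : Tract G} {E : Type*} [Fintype E]
  {M : Matroid E} {C : Set (E → WithZero G)}

/-- Orthogonality of circuits and cocircuits implies strong modular elimination. -/
theorem IsSignature.exists_strong_elimination (hC : F.IsSignature M C)
    (hpair : ∀ X ∈ C, ∀ Y, F.IsCocircuitVector M C Y → pairing X Y ∈ F.null) {k : ℕ}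
    {Xs : Fin k → E → WithZero G} {X : E → WithZero G} {e : Fin k → E} {x : E}
    (hXs : ∀ i, Xs i ∈ C) (hX : X ∈ C) (hx : x ∈ supp X) (hxs : x ∉ ⋃ i, supp (Xs i))
    (he : ∀ i, e i ∈ supp X ∩ supp (Xs i) ∧ ∀ j, j ≠ i → e i ∉ supp (Xs j))
    (hXe : ∀ i, X (e i) = F.neg (Xs i (e i))) {U : Set E}
    (hU : U = supp X ∪ ⋃ i, supp (Xs i))
    (huniq : ∀ B D, M.IsCircuit B → M.IsCircuit D → B ⊆ U \ range e → D ⊆ U \ range e → D = B) :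
    ∃ Z ∈ C, (∀ i, Z (e i) = 0) ∧
      ∀ f, ∑ i, incl (Xs i f) + incl (X f) + incl (F.neg (Z f)) ∈ F.null := by
  classical
  have hXc := hC.isCircuit X hX
  have hXsc := fun i => hC.isCircuit (Xs i) (hXs i)
  obtain ⟨S, hS, hxS, hSU⟩ := hXc.exists_isCircuit_avoiding hXsc he hx hxs
  rw [← hU] at hSU
  obtain ⟨Z₀, hZ₀, rfl⟩ := hC.exists_supp_eq S hS
  obtain ⟨α, hα⟩ := exists_coe_eq (hxS : Z₀ x ≠ 0) hx
  have hZ := hC.scale_mem Z₀ hZ₀ α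
  have hZx : scale α Z₀ x = X x := hα
  have hZU : supp (scale α Z₀) ⊆ U \ range e := by rwa [supp_scale]
  generalize scale α Z₀ = Z at hZ hZx hZU
  have hXU : supp X ⊆ U := hU ▸ subset_union_left
  have hXsU : ∀ i, supp (Xs i) ⊆ U := fun i =>
    hU ▸ (subset_iUnion (fun i => supp (Xs i)) i).trans subset_union_right
  have hxsi : ∀ i, x ∉ supp (Xs i) := fun i h => hxs (mem_iUnion.2 ⟨i, h⟩)
  have hxe : ∀ i, e i ≠ x := fun i h => hxsi i (h ▸ (he i).1.2)
  have hinj : Function.Injective e := fun i j hij => by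
    by_contra hne
    exact (he i).2 j (Ne.symm hne) (hij ▸ (he j).1.2)
  have hZe : ∀ i, Z (e i) = 0 := fun i => notMem_supp.1 fun h => (hZU h).2 ⟨i, rfl⟩
  have hUE : U ⊆ M.E := by
    rw [hU]
    exact union_subset hXc.subset_ground (iUnion_subset fun i => (hXsc i).subset_ground)
  -- The support of `Z₀` is the only circuit in U minus the e_i, and it contains x.
  have hI : M.Indep ((U \ range e) \ {x}) := by
    rw [indep_iff_forall_subset_not_isCircuit ((sdiff_subset.trans sdiff_subset).trans hUE)]
    intro D hD hDc
    have := huniq (supp Z₀) D hS hDc hSU (hD.trans sdiff_subset)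
    exact (hD (this ▸ hxS)).2 rfl
  refine ⟨Z, hZ, hZe, fun f => ?_⟩
  by_cases hfU : f ∈ U
  swap
  · have h1 : ∀ i, Xs i f = 0 := fun i => notMem_supp.1 fun h => hfU (hXsU i h)
    have h2 : X f = 0 := notMem_supp.1 fun h => hfU (hXU h)
    have h3 : Z f = 0 := notMem_supp.1 fun h => hfU (hZU h).1
    simp only [h1, h2, h3, neg_zero, incl_zero, Finset.sum_const_zero, add_zero]
    exact F.zero_mem
  by_cases hfe : f ∈ range e
  · obtain ⟨i, rfl⟩ := hfe
    rw [hZe, neg_zero, incl_zero, add_zero, Finset.sum_eq_single i, hXe]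
    · exact incl_add_incl_neg_mem _
    · intro j _ hji
      rw [notMem_supp.1 ((he i).2 j hji), incl_zero]
    · exact fun h => (h (Finset.mem_univ _)).elim
  by_cases hfx : f = x
  · subst hfx
    rw [hZx, Finset.sum_eq_zero fun i _ => by rw [notMem_supp.1 (hxsi i), incl_zero], zero_add]
    exact incl_add_incl_neg_mem _
  have hfI : f ∈ (U \ range e) \ {x} := ⟨⟨hfU, hfe⟩, hfx⟩
  -- This cocircuit meets U at most in f, x and the e_i. Two-term pairings with X_i and Z rewrite
  -- the summands at f, times Y(f), as X(e_i)Y(e_i) and X(x)Y(x); together with X(f)Y(f) they form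
  -- the pairing of X with Y.
  obtain ⟨K, hK, hKI⟩ := hI.exists_isCocircuit_inter_eq_mem hfI
  obtain ⟨Y, hY, rfl⟩ := hC.exists_isCocircuitVector hK
  have hfY : f ∈ supp Y := (by rw [hKI]; rfl : f ∈ supp Y ∩ ((U \ range e) \ {x})).1
  have hKU : ∀ z ∈ supp Y, z ∈ U → z ∉ range e → z ≠ x → z = f := by
    intro z hz hzU hze hzx
    have : z ∈ supp Y ∩ ((U \ range e) \ {x}) := ⟨hz, ⟨hzU, hze⟩, hzx⟩
    rwa [hKI] at this
  have hef : ∀ i, e i ≠ f := fun i h => hfe ⟨i, h⟩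
  have h₁ : ∀ i, Y f * Xs i f = X (e i) * Y (e i) := by
    intro i
    have := (pairing_pair (hef i) (by
      rintro z ⟨hz, hzY⟩
      by_cases hze : z ∈ range e
      · obtain ⟨j, rfl⟩ := hze
        by_cases hij : i = j
        · exact Or.inl (by rw [hij])
        · exact ((he j).2 i hij hz).elim
      · exact Or.inr (hKU z hzY (hXsU i hz) hze fun h => hxsi i (h ▸ hz)))).1
      (hpair _ (hXs i) Y hY)
    rw [mul_comm, this, hXe, neg_mul]
  have h₂ : Y f * F.neg (Z f) = X x * Y x := by
    have := (pairing_pair (Ne.symm hfx) (by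
      rintro z ⟨hz, hzY⟩
      by_cases hzx : z = x
      · exact Or.inl hzx
      · exact Or.inr (hKU z hzY (hZU hz).1 (hZU hz).2 hzx))).1 (hpair _ hZ Y hY)
    rw [mul_neg, mul_comm, this, neg_neg, hZx]
  have h₃ := hpair X hX Y hY
  rw [pairing_eq_sum (s := insert f (insert x (Finset.univ.image e))), Finset.sum_insert,
    Finset.sum_insert, Finset.sum_image fun i _ j _ h => hinj h] at h₃
  · refine mem_null_of_incl_mul_mem hfY ?_
    rw [mul_add, mul_add, Finset.mul_sum]
    simp only [← incl_mul, h₁, h₂]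
    rw [mul_comm (Y f)]
    convert! h₃ using 1
    abel
  · simpa using hxe
  · simpa [hfx] using hef
  · rintro z ⟨hz, hzY⟩
    by_cases hze : z ∈ range e
    · obtain ⟨j, rfl⟩ := hze
      simp
    · by_cases hzx : z = x
      · simp [hzx]
      · simp [hKU z hzY (hXU hz) hze hzx]

end Tract

theorem theorem3p22 {G : Type u} [CommGroup G] (F : Tract G) (τ : F.Involution)
    (hF : Tract.IsPerfect.{u, v} F τ) (E : Type v) [Fintype E]
    (C : Set (E → WithZero G)) (hC : F.IsWeakCircuitSet C) :
    F.IsStrongCircuitSet C := by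
  obtain ⟨M, -, hM⟩ := hC.exists_isSignature
  refine ⟨hC.zero_notMem, hC.smul_mem, hC.incomparable, ?_⟩
  rintro k Xs X e hXs hX ⟨-, hU, hheight⟩ hnss he hXe
  obtain ⟨x, hx, hxs⟩ := Set.not_subset.1 hnss
  have hUnion : (⋃ i, (Fin.cons (Tract.supp X) (fun i => Tract.supp (Xs i)) :
      Fin (k + 1) → Set E) i) = Tract.supp X ∪ ⋃ i, Tract.supp (Xs i) := by
    ext z
    simp
  have hcirc : ∀ B, M.IsCircuit B → B ∈ Tract.supports C := hM.exists_supp_eq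
  refine hM.exists_strong_elimination (fun X hX Y hY => hM.pairing_mem hF hX hY) hXs hX hx hxs he
    hXe hUnion fun B D hB hD hBU hDU => ?_
  -- The modular family includes X besides the k circuits X_i, hence height k + 1.
  refine Tract.eq_of_height_le hU hheight.le (fun i => ⟨Xs i, hXs i, rfl⟩) (fun i => ?_)
    (fun i => ⟨(he i).1.2, (he i).2⟩) (hcirc B hB) (hcirc D hD) hB.nonempty
    (hD.eq_of_subset_isCircuit hB) hBU hDU
  rw [hUnion]
  exact (Set.subset_iUnion (fun i => Tract.supp (Xs i)) i).trans Set.subset_union_right
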